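/- Let $X$ be a connected complex manifold of dimension $2$ (for example a smooth projective surface), let $N$ and $L$ be holomorphic line bundles on $X$, let $k\ge 1$ and $d\ge 1$, and let $|W|=\mathbb P(W)$, with $W\subset H^0(X,N)$ a vector subspace of dimension $k+1$, be a linear system of dimension $k$. Let $v\in H^0(X,\mathrm{Sym}^d TX\otimes L)$ define a $d$-web $\mathcal W$, i.e. $v\not\equiv 0$ and its discriminant $\Delta(v)\in H^0(X,\det(TX)^{d(d-1)}\otimes L^{\otimes 2(d-1)})$ is not identically zero. For a basis $s_0,\dots,s_k$ of $W$, written as functions in a local trivialization of $N$, and a local holomorphic vector field $w$, put $\sigma_W(w)=\det\bigl(w^i(s_j)\bigr)_{0\le i,j\le k}$ (the Wronskian of the $s_j$ along the integral curves of $w$). Where $v$ is locally a product $v=v_1\cdots v_d$ of holomorphic vector fields (in a local trivialization of $L$), put $\sigma_W(v)=\prod_{i}\sigma_W(v_i)$; this defines a meromorphic section of a line bundle on $X$, holomorphic outside the zero set of $\Delta(v)$. The extactic divisor $\mathcal E(\mathcal W,W)$ is the divisor of $\Delta(v)^{k(k-1)/2}\cdot\sigma_W(v)$; if this section vanishes identically,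 every irreducible curve is regarded as having infinite multiplicity in $\mathcal E(\mathcal W,W)$. Let $C\subset X$ be an irreducible curve (an irreducible closed analytic subset of pure dimension $1$) invariant by $\mathcal W$: at every smooth point $p$ of $C$, if $f$ is a local equation of $C$ with $df_p\neq 0$, then $v(p)(df_p,\dots,df_p)=0$; equivalently, $v(p)=0$ or $T_pC$ is one of the directions of $\mathcal W$ at $p$. Let $k_C$ be the dimension of the restriction of $|W|$ to $C$, i.e. $k_C+1$ is the dimension of the image of $W$ in the space of sections of $N|_C$. Then $$(k-k_C)\,C\;\le\;\mathcal E(\mathcal W,W),$$ that is, $C$ has multiplicity at least $k-k_C$ in $\mathcal E(\mathcal W,W)$, and every irreducible curve has multiplicity at least $0$ in $\mathcal E(\mathcal W,W)$. -/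

import Mathlib

open scoped Manifold ContDiff Topology
open Bundle

namespace ExtacticWeb

noncomputable section

/-! ## Local notions in the coordinate plane -/

/-- The iterated derivatives `w^j (g)` of a function `g` along a vector field `w` on `ℂ²`. -/
def iterLie (w : ℂ × ℂ → ℂ × ℂ) : ℕ → (ℂ × ℂ → ℂ) → (ℂ × ℂ → ℂ)
  | 0, g => g
  | j + 1, g => fun z => fderiv ℂ (iterLie w j g) z (w z)

/-- The Wronskian jet differential of the functions `g_0, …, g_k`, evaluated on a germ of curve
`γ : (ℂ, 0) → ℂ²`: the determinant of the matrix of derivatives `(g_j ∘ γ)^(i) (0)`. -/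
def jetWronskian {k : ℕ} (g : Fin (k + 1) → ℂ × ℂ → ℂ) (γ : ℂ → ℂ × ℂ) : ℂ :=
  Matrix.det (Matrix.of fun i j : Fin (k + 1) => iteratedDeriv (i : ℕ) (g j ∘ γ) 0)

/-- The action of the Wronskian jet differential of `g_0, …, g_k` on a vector field `w`: at the
point `z` it is the determinant of the matrix with entries `w^i (g_j) (z)`. By
`jetWronskian_eq_action` this is the value of the jet differential on the germ of integral curve of
`w` through `z`. -/
def action {k : ℕ} (g : Fin (k + 1) → ℂ × ℂ → ℂ) (w : ℂ × ℂ → ℂ × ℂ) (z : ℂ × ℂ) : ℂ :=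
  Matrix.det (Matrix.of fun i j : Fin (k + 1) => iterLie w (i : ℕ) (g j) z)

theorem analyticAt_iterLie {w : ℂ × ℂ → ℂ × ℂ} {g : ℂ × ℂ → ℂ} {z : ℂ × ℂ}
    (hw : AnalyticAt ℂ w z) (hg : AnalyticAt ℂ g z) (j : ℕ) :
    AnalyticAt ℂ (iterLie w j g) z := by
  induction j with
  | zero => exact hg
  | succ j ih =>
    have h1 := (ContinuousLinearMap.id ℂ (ℂ × ℂ →L[ℂ] ℂ)).analyticAt_bilinear
      (fderiv ℂ (iterLie w j g) z, w z)
    have h2 := AnalyticAt.comp (f := fun x => (fderiv ℂ (iterLie w j g) x, w x)) (x := z) h1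
      (ih.fderiv.prod hw)
    exact h2

theorem jetWronskian_eq_action {k : ℕ} {g : Fin (k + 1) → ℂ × ℂ → ℂ} {w : ℂ × ℂ → ℂ × ℂ}
    {z : ℂ × ℂ} {γ : ℂ → ℂ × ℂ} (hg : ∀ j, AnalyticAt ℂ (g j) z) (hw : AnalyticAt ℂ w z)
    (h0 : γ 0 = z) (hγ : ∀ᶠ t in 𝓝 (0 : ℂ), HasDerivAt γ (w (γ t)) t) :
    jetWronskian g γ = action g w z := by
  have key : ∀ (j : Fin (k + 1)) (i : ℕ),
      iteratedDeriv i (g j ∘ γ) =ᶠ[𝓝 0] (iterLie w i (g j) ∘ γ) := by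
    intro j i
    induction i with
    | zero => simp [iterLie]
    | succ i ih =>
      rw [iteratedDeriv_succ]
      have hA : ∀ᶠ x in 𝓝 z, AnalyticAt ℂ (iterLie w i (g j)) x :=
        (analyticAt_iterLie hw (hg j) i).eventually_analyticAt
      have hc : Filter.Tendsto γ (𝓝 0) (𝓝 z) := by
        rw [← h0]
        exact hγ.self_of_nhds.continuousAt
      filter_upwards [ih.deriv, hγ, hc.eventually hA] with t h1 h2 h3
      rw [h1]
      exact (h3.differentiableAt.hasFDerivAt.comp_hasDerivAt t h2).deriv
  unfold jetWronskian action
  congr 1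
  ext i j
  simpa [h0] using (key j i).self_of_nhds

/-- The discriminant of the binary form `u_1 ⋯ u_d`, a product of vectors of `ℂ²`. -/
def discProd {d : ℕ} (u : Fin d → ℂ × ℂ) : ℂ :=
  ∏ i, ∏ j ∈ Finset.Ioi i, ((u i).1 * (u j).2 - (u i).2 * (u j).1) ^ 2

/-- `F z ξ` is the value at the covector `ξ = (ξ₁, ξ₂)` of a symmetric `d`-vector field at the point
`z`. The vector fields `u_1, …, u_d`, holomorphic at `z`, satisfy `F = u_1 ⋯ u_d` near `z`. -/
def IsDecomposition {d : ℕ} (F : ℂ × ℂ → ℂ × ℂ → ℂ) (u : Fin d → ℂ × ℂ → ℂ × ℂ)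
    (z : ℂ × ℂ) : Prop :=
  (∀ i, AnalyticAt ℂ (u i) z) ∧
    ∀ᶠ y in 𝓝 z, ∀ ξ : ℂ × ℂ, F y ξ = ∏ i, (ξ.1 * (u i y).1 + ξ.2 * (u i y).2)

/-- `E` is, near `z₀`, the holomorphic extension of `Δ(v) ^ (k (k - 1) / 2) · σ_W(v)`, where the
symmetric `d`-vector field `v` is given by `F` and the jet differential `σ_W` is the Wronskian of
`g_0, …, g_k`. Outside the discriminant `v` is locally a product `u_1 ⋯ u_d` and
`σ_W(v) = ∏ σ_W(u_i)`. -/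
def IsExtacticFunction (d : ℕ) {k : ℕ} (F : ℂ × ℂ → ℂ × ℂ → ℂ) (g : Fin (k + 1) → ℂ × ℂ → ℂ)
    (E : ℂ × ℂ → ℂ) (z₀ : ℂ × ℂ) : Prop :=
  AnalyticAt ℂ E z₀ ∧
    ∀ᶠ z in 𝓝 z₀, ∀ u : Fin d → ℂ × ℂ → ℂ × ℂ, IsDecomposition F u z →
      discProd (fun i => u i z) ≠ 0 →
        E z = discProd (fun i => u i z) ^ (k * (k - 1) / 2) * ∏ i, action g (u i) z

/-- `f` is a local equation, with nonzero differential, of the set `A` at its point `z`. -/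
def IsSmoothEquation (A : Set (ℂ × ℂ)) (f : ℂ × ℂ → ℂ) (z : ℂ × ℂ) : Prop :=
  z ∈ A ∧ AnalyticAt ℂ f z ∧ fderiv ℂ f z ≠ 0 ∧ ∀ᶠ y in 𝓝 z, (y ∈ A ↔ f y = 0)

/-! ## Curves on complex surfaces -/

section Surface

variable {X : Type*} [TopologicalSpace X] [ChartedSpace (ℂ × ℂ) X]

/-- The differential of a function, as a covector. -/
def dform (g : X → ℂ) (x : X) : TangentSpace 𝓘(ℂ, ℂ × ℂ) x →L[ℂ] ℂ :=
  mfderiv 𝓘(ℂ, ℂ × ℂ) 𝓘(ℂ, ℂ) g x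

/-- Closed analytic subsets: locally the common zeros of finitely many holomorphic functions. -/
def IsAnalyticSubset (A : Set X) : Prop :=
  IsClosed A ∧ ∀ p ∈ A, ∃ U : Set X, IsOpen U ∧ p ∈ U ∧ ∃ (n : ℕ) (f : Fin n → X → ℂ),
    (∀ i, ContMDiffOn 𝓘(ℂ, ℂ × ℂ) 𝓘(ℂ, ℂ) ω (f i) U) ∧ ∀ x ∈ U, (x ∈ A ↔ ∀ i, f i x = 0)

/-- `f` is a holomorphic local equation of `C` at the point `p ∈ C`, with nonzero differential
at `p`; in particular `p` is a smooth point of `C`. -/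
def IsLocalEquation (C : Set X) (f : X → ℂ) (p : X) : Prop :=
  p ∈ C ∧ ContMDiffAt 𝓘(ℂ, ℂ × ℂ) 𝓘(ℂ, ℂ) ω f p ∧ dform f p ≠ 0 ∧
    ∀ᶠ x in 𝓝 p, (x ∈ C ↔ f x = 0)

/-- Irreducible curves: nonempty closed analytic subsets of pure dimension one (the points at which
they are smooth of dimension one are dense in them) which are not the union of two proper closed
analytic subsets. -/
structure IsIrreducibleCurve (C : Set X) : Prop where
  nonempty : C.Nonempty
  analytic : IsAnalyticSubset C
  pure_dim_one : C ⊆ closure {p | ∃ f, IsLocalEquation C f p}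
  irreducible : ∀ A B : Set X, IsAnalyticSubset A → IsAnalyticSubset B → C = A ∪ B →
    C = A ∨ C = B

/-! ## Linear systems -/

/-- Restriction of the global holomorphic sections of `N` to the subset `C`. -/
def restrictSection (N : X → Type*) [TopologicalSpace (TotalSpace ℂ N)]
    [∀ x, TopologicalSpace (N x)] [∀ x, AddCommGroup (N x)] [∀ x, Module ℂ (N x)]
    [FiberBundle ℂ N] [VectorBundle ℂ ℂ N] (C : Set X) :
    ContMDiffSection 𝓘(ℂ, ℂ × ℂ) ℂ ω N →ₗ[ℂ] ((x : C) → N x) where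
  toFun s x := s x
  map_add' _ _ := rfl
  map_smul' _ _ := rfl

/-- The (projective) dimension of the restriction to `C` of the linear system `|W|`; it is `-1`
when every element of `W` vanishes on `C`. -/
def restrictedDim {N : X → Type*} [TopologicalSpace (TotalSpace ℂ N)]
    [∀ x, TopologicalSpace (N x)] [∀ x, AddCommGroup (N x)] [∀ x, Module ℂ (N x)]
    [FiberBundle ℂ N] [VectorBundle ℂ ℂ N]
    (W : Submodule ℂ (ContMDiffSection 𝓘(ℂ, ℂ × ℂ) ℂ ω N)) (C : Set X) : ℤ :=
  (Module.finrank ℂ (W.map (restrictSection N C)) : ℤ) - 1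

/-! ## Webs -/

/-- Holomorphic sections of `Sym^d TX ⊗ L`. An element of the fibre at `x` is given as a symmetric
`d`-linear map on the cotangent space of `X` at `x` with values in `L x`; it depends
holomorphically on `x` when its values on differentials of holomorphic functions are holomorphic
sections of `L`. -/
structure TwistedSymField (d : ℕ) (L : X → Type*) [TopologicalSpace (TotalSpace ℂ L)]
    [∀ x, TopologicalSpace (L x)] [∀ x, AddCommGroup (L x)] [∀ x, Module ℂ (L x)]
    [FiberBundle ℂ L] [VectorBundle ℂ ℂ L] where
  toFun : (x : X) →
    MultilinearMap ℂ (fun _ : Fin d => TangentSpace 𝓘(ℂ, ℂ × ℂ) x →L[ℂ] ℂ) (L x)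
  symmetric : ∀ (x : X) (τ : Equiv.Perm (Fin d))
    (ξ : Fin d → TangentSpace 𝓘(ℂ, ℂ × ℂ) x →L[ℂ] ℂ),
      toFun x (fun i => ξ (τ i)) = toFun x ξ
  holomorphic : ∀ (U : Set X) (g : Fin d → X → ℂ), IsOpen U →
    (∀ i, ContMDiffOn 𝓘(ℂ, ℂ × ℂ) 𝓘(ℂ, ℂ) ω (g i) U) →
      ContMDiffOn 𝓘(ℂ, ℂ × ℂ) (𝓘(ℂ, ℂ × ℂ).prod 𝓘(ℂ, ℂ)) ω
        (fun x => TotalSpace.mk' ℂ x (toFun x fun i => dform (g i) x)) U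

variable {N L : X → Type*}
  [TopologicalSpace (TotalSpace ℂ N)] [∀ x, TopologicalSpace (N x)] [∀ x, AddCommGroup (N x)]
  [∀ x, Module ℂ (N x)] [FiberBundle ℂ N] [VectorBundle ℂ ℂ N]
  [TopologicalSpace (TotalSpace ℂ L)] [∀ x, TopologicalSpace (L x)] [∀ x, AddCommGroup (L x)]
  [∀ x, Module ℂ (L x)] [FiberBundle ℂ L] [VectorBundle ℂ ℂ L]

/-- `v` defines a `d`-web: neither `v` nor its discriminant is identically zero, that is, at some
point `v` is a product of `d` nonzero, pairwise non-proportional tangent vectors (times a nonzero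
element of the fibre of `L`). -/
def IsWeb {d : ℕ} (v : TwistedSymField d L) : Prop :=
  ∃ (x : X) (u : Fin d → TangentSpace 𝓘(ℂ, ℂ × ℂ) x) (e : L x), e ≠ 0 ∧ (∀ i, u i ≠ 0) ∧
    (∀ i j, i ≠ j → LinearIndependent ℂ ![u i, u j]) ∧
    ∀ ξ : TangentSpace 𝓘(ℂ, ℂ × ℂ) x →L[ℂ] ℂ,
      v.toFun x (fun _ => ξ) = (∏ i, ξ (u i)) • e

/-- `C` is invariant by the web defined by `v`: at every smooth point `p` of `C` the conormal
direction `df` of `C` satisfies `v (df, …, df) = 0`; in other words, the tangent line of `C` is one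
of the directions of the web, or `v` vanishes at `p`. -/
def IsInvariant {d : ℕ} (C : Set X) (v : TwistedSymField d L) : Prop :=
  ∀ (p : X) (f : X → ℂ), IsLocalEquation C f p → v.toFun p (fun _ => dform f p) = 0

/-! ## The extactic divisor -/

/-- The section `s` in the coordinates `φ` and the trivialization `e`. -/
def localSection (φ : OpenPartialHomeomorph X (ℂ × ℂ))
    (e : Trivialization ℂ (TotalSpace.proj : TotalSpace ℂ N → X))
    (s : (x : X) → N x) (z : ℂ × ℂ) : ℂ :=
  (e (TotalSpace.mk' ℂ (φ.symm z) (s (φ.symm z)))).2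

/-- The symmetric vector field `v` in the coordinates `φ = (φ₁, φ₂)` and the trivialization `e`:
its value at the covector `ξ₁ dφ₁ + ξ₂ dφ₂`. -/
def localWeb {d : ℕ} (φ : OpenPartialHomeomorph X (ℂ × ℂ))
    (e : Trivialization ℂ (TotalSpace.proj : TotalSpace ℂ L → X))
    (v : TwistedSymField d L) (z ξ : ℂ × ℂ) : ℂ :=
  (e (TotalSpace.mk' ℂ (φ.symm z) (v.toFun (φ.symm z) fun _ =>
    ξ.1 • dform (fun y => (φ y).1) (φ.symm z) + ξ.2 • dform (fun y => (φ y).2) (φ.symm z)))).2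

/-- The irreducible curve `H` has coefficient at least `n` in the extactic divisor of the web
defined by `v` with respect to the linear system `|W|` of dimension `k`: in all holomorphic
coordinates of `X`, trivializations of `N` and `L`, and bases of `W`, at general points of `H`
the function `Δ(v) ^ (k (k - 1) / 2) · σ_W(v)` extends holomorphically and is divisible by the
`n`-th power of an equation of `H`. -/
def ExtacticCoeffGE (k : ℕ) (W : Submodule ℂ (ContMDiffSection 𝓘(ℂ, ℂ × ℂ) ℂ ω N)) {d : ℕ}
    (v : TwistedSymField d L) (H : Set X) (n : ℕ) : Prop :=
  ∀ φ ∈ IsManifold.maximalAtlas 𝓘(ℂ, ℂ × ℂ) ω X,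
  ∀ (eN : Trivialization ℂ (TotalSpace.proj : TotalSpace ℂ N → X)) [MemTrivializationAtlas eN]
    (eL : Trivialization ℂ (TotalSpace.proj : TotalSpace ℂ L → X)) [MemTrivializationAtlas eL]
    (s : Module.Basis (Fin (k + 1)) ℂ W),
    H ∩ (φ.source ∩ eN.baseSet ∩ eL.baseSet) ⊆
      closure {q | q ∈ H ∩ (φ.source ∩ eN.baseSet ∩ eL.baseSet) ∧ ∃ f E h : ℂ × ℂ → ℂ,
        IsSmoothEquation (φ.target ∩ φ.symm ⁻¹' H) f (φ q) ∧
        IsExtacticFunction d (localWeb φ eL v)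
          (fun j => localSection φ eN (s j : ContMDiffSection 𝓘(ℂ, ℂ × ℂ) ℂ ω N)) E (φ q) ∧
        AnalyticAt ℂ h (φ q) ∧ ∀ᶠ z in 𝓝 (φ q), E z = f z ^ n * h z}

end Surface

end

end ExtacticWeb

namespace ExtacticWeb

/-! ## Division of holomorphic functions by the equation of a smooth curve -/

/-! The extactic section is a resultant, and its vanishing along `C` is read off from an ideal
preserved by a derivation.

Write `v` locally as `f ^ m` times a form not vanishing identically on the curve `f = 0`. At a
general point of the curve choose `t` so that the covector `(1, t)` kills no direction of that form.
The directions are then `w = A + x • B`, with `A = (1, 0)`, `B = (-t, 1)`, and the slopes `x` are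
the roots of a monic polynomial `P` over the ring `R` of holomorphic functions. Along a branch `s`
of roots, differentiating `P(s) = 0` shows that `P'(s) w` comes from a derivation of `R[X]`, namely
`webDer`. A first derivative `w g` is already polynomial in `s`, so `webDet`, the Wronskian built
from these rows, equals `P'(s) ^ (k(k-1)/2)` times the true Wronskian (`eval₂_webDet`). The product
over all roots turns the factors `P'(s_i)` into the discriminant. Hence, up to sign and a power of
the leading coefficient, the extactic function is `Res(P, webDet)` (`extacticFn_eq`). In particular
it is holomorphic, which gives multiplicity at least 0.

If the curve is invariant and `m = 0`, its tangent slope extends to a holomorphic `c` with `f ∣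
P(c)`. The ideal `(f, X - c)` of the lifted curve is stable under `webDer`, so every section
vanishing on the curve gives a column of `webDet` with entries in it. With `n` independent such
sections, `webDet` lies in the `n`-th power of the ideal (`webDet_mem_span_pow`). The product of `|x
- c|` over the roots `x` of `P` is `|P(c)| = O(|f|)`, whence `Res(P, webDet) = O(|f| ^ n)`
(`exists_bound_resultant`), and such a bound implies divisibility by `f ^ n`
(`exists_analyticAt_eq_pow_mul`). Nothing requires `c` to be a simple root, so the curve may lie in
the discriminant.

If `m ≥ 1`, the power of the leading coefficient alone supplies `f ^ k`. This is enough unless all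
of `W` vanishes on the curve; then the undifferentiated row of `webDet` is divisible by `f`, which
supplies the missing factor. -/

theorem analyticAt_intervalIntegral_comp_clm {E F : Type*} [NormedAddCommGroup E]
    [NormedSpace ℂ E] [NormedAddCommGroup F] [NormedSpace ℂ F] [CompleteSpace F] {f : E → F}
    (hf : AnalyticAt ℂ f 0) {T : ℝ → E →L[ℂ] E} (hT : Continuous T)
    (hT1 : ∀ τ ∈ Set.Icc (0 : ℝ) 1, ‖T τ‖ ≤ 1) :
    AnalyticAt ℂ (fun z => ∫ τ in (0 : ℝ)..1, f (T τ z)) 0 := by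
  obtain ⟨p, r, hp⟩ := hf
  have hcont : ∀ n, Continuous fun τ => (p n).compContinuousLinearMap fun _ => T τ := by
    intro n
    have h1 : Continuous (ContinuousMultilinearMap.compContinuousLinearMapContinuousMultilinear
      ℂ (fun _ : Fin n => E) (fun _ : Fin n => E) F) := ContinuousMultilinearMap.cont _
    have h2 : Continuous fun τ : ℝ => (fun _ : Fin n => T τ) := continuous_pi fun _ => hT
    exact (h1.comp h2).clm_apply continuous_const
  have hint : ∀ τ ∈ Set.uIoc (0 : ℝ) 1, τ ∈ Set.Icc (0 : ℝ) 1 := by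
    intro τ hτ
    rw [Set.uIoc_of_le zero_le_one] at hτ
    exact Set.Ioc_subset_Icc_self hτ
  have hbound : ∀ n, ∀ τ ∈ Set.uIoc (0 : ℝ) 1,
      ‖(p n).compContinuousLinearMap fun _ => T τ‖ ≤ ‖p n‖ := by
    intro n τ hτ
    refine (ContinuousMultilinearMap.norm_compContinuousLinearMap_le _ _).trans ?_
    refine mul_le_of_le_one_right (norm_nonneg _) ?_
    exact Finset.prod_le_one (fun _ _ => norm_nonneg _) fun _ _ => hT1 τ (hint τ hτ)
  -- The power series is integrated term by term. Since each `T τ` is a contraction, the new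
  -- coefficients are bounded by the old ones and the ball of convergence is kept.
  let q : FormalMultilinearSeries ℂ E F := fun n =>
    ∫ τ in (0 : ℝ)..1, (p n).compContinuousLinearMap fun _ => T τ
  have hq : ∀ n, ‖q n‖ ≤ ‖p n‖ := by
    intro n
    simpa using intervalIntegral.norm_integral_le_of_norm_le_const (hbound n)
  refine ⟨q, r, ?_, hp.r_pos, ?_⟩
  · refine hp.r_le.trans (ENNReal.le_of_forall_nnreal_lt fun s hs => ?_)
    obtain ⟨C, -, hC⟩ := p.norm_mul_pow_le_of_lt_radius hs
    exact q.le_radius_of_bound C fun n =>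
      (mul_le_mul_of_nonneg_right (hq n) (by positivity)).trans (hC n)
  · intro y hy
    have hq' : ∀ n, q n (fun _ => y) = ∫ τ in (0 : ℝ)..1, p n (fun _ => T τ y) := by
      intro n
      exact ((ContinuousMultilinearMap.apply ℂ (fun _ : Fin n => E) F
        (fun _ => y)).intervalIntegral_comp_comm (μ := MeasureTheory.volume)
        ((hcont n).intervalIntegrable 0 1)).symm
    simp only [hq', zero_add]
    have hyr : (‖y‖₊ : ENNReal) < p.radius := by
      rw [Metric.mem_eball, edist_zero_right] at hy
      exact lt_of_lt_of_le hy hp.r_le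
    have hsum : Summable fun n => ‖p n‖ * ‖y‖ ^ n := by
      have := p.summable_norm_mul_pow hyr
      rwa [coe_nnnorm] at this
    have hTy : ∀ τ ∈ Set.uIoc (0 : ℝ) 1, ‖T τ y‖ ≤ ‖y‖ := fun τ hτ => by
      have := (T τ).le_of_opNorm_le (hT1 τ (hint τ hτ)) y
      rwa [one_mul] at this
    have hm : ∀ n, Continuous fun τ => p n (fun _ => T τ y) := fun n => by
      have h2 : Continuous fun τ : ℝ => (fun _ : Fin n => T τ y) :=
        continuous_pi fun _ => hT.clm_apply continuous_const
      exact (p n).cont.comp h2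
    have hle : ∀ n, ∀ τ ∈ Set.uIoc (0 : ℝ) 1, ‖p n (fun _ => T τ y)‖ ≤ ‖p n‖ * ‖y‖ ^ n := by
      intro n τ hτ
      have h1 := (p n).le_opNorm fun _ => T τ y
      rw [Finset.prod_const, Finset.card_univ, Fintype.card_fin] at h1
      exact h1.trans (by gcongr; exact hTy τ hτ)
    refine intervalIntegral.hasSum_integral_of_dominated_convergence
      (fun n _ => ‖p n‖ * ‖y‖ ^ n) (fun n => (hm n).aestronglyMeasurable)
      (fun n => Filter.Eventually.of_forall (hle n)) ?_ ?_ ?_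
    · exact Filter.Eventually.of_forall fun τ hτ => hsum
    · exact intervalIntegrable_const
    · refine Filter.Eventually.of_forall fun τ hτ => ?_
      have : T τ y ∈ Metric.eball (0 : E) r := by
        rw [Metric.mem_eball, edist_zero_right] at hy ⊢
        exact lt_of_le_of_lt (enorm_le_iff_norm_le.2 (hTy τ hτ)) hy
      simpa using hp.hasSum this

/-- Hadamard's lemma. -/
theorem exists_analyticAt_eq_fst_mul {G : ℂ × ℂ → ℂ} (hG : AnalyticAt ℂ G 0)
    (h0 : ∀ᶠ w in 𝓝 (0 : ℂ × ℂ), w.1 = 0 → G w = 0) :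
    ∃ H : ℂ × ℂ → ℂ, AnalyticAt ℂ H 0 ∧ ∀ᶠ w in 𝓝 (0 : ℂ × ℂ), G w = w.1 * H w := by
  let T : ℝ → (ℂ × ℂ) →L[ℂ] ℂ × ℂ := fun τ =>
    (τ : ℂ) • (ContinuousLinearMap.inl ℂ ℂ ℂ).comp (ContinuousLinearMap.fst ℂ ℂ ℂ) +
      (ContinuousLinearMap.inr ℂ ℂ ℂ).comp (ContinuousLinearMap.snd ℂ ℂ ℂ)
  have hTa : ∀ τ w, T τ w = ((τ : ℂ) * w.1, w.2) := by
    intro τ w; simp [T]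
  have hT : Continuous T := by fun_prop
  have hT1 : ∀ τ ∈ Set.Icc (0 : ℝ) 1, ‖T τ‖ ≤ 1 := by
    intro τ hτ
    refine ContinuousLinearMap.opNorm_le_bound _ zero_le_one fun w => ?_
    rw [hTa, one_mul, Prod.norm_def, Prod.norm_def]
    refine max_le_max ?_ le_rfl
    rw [norm_mul, Complex.norm_real, Real.norm_of_nonneg hτ.1]
    exact mul_le_of_le_one_left (norm_nonneg _) hτ.2
  have hder : AnalyticAt ℂ (fun w => fderiv ℂ G w (1, 0)) 0 :=
    ((ContinuousLinearMap.apply ℂ ℂ ((1, 0) : ℂ × ℂ)).analyticAt _).comp hG.fderiv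
  refine ⟨_, analyticAt_intervalIntegral_comp_clm hder hT hT1, ?_⟩
  obtain ⟨ε, hε, hball⟩ := Metric.eventually_nhds_iff_ball.1
    (hG.eventually_analyticAt.and h0)
  filter_upwards [Metric.ball_mem_nhds (0 : ℂ × ℂ) hε] with w hw
  have hmem : ∀ τ ∈ Set.uIcc (0 : ℝ) 1, ((τ : ℂ) * w.1, w.2) ∈ Metric.ball (0 : ℂ × ℂ) ε := by
    intro τ hτ
    rw [Set.uIcc_of_le zero_le_one] at hτ
    rw [mem_ball_zero_iff] at hw ⊢
    refine lt_of_le_of_lt ?_ hw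
    rw [← hTa]
    simpa using (T τ).le_of_opNorm_le (hT1 τ hτ) w
  have hd : ∀ τ ∈ Set.uIcc (0 : ℝ) 1, HasDerivAt (fun τ : ℝ => G ((τ : ℂ) * w.1, w.2))
      (w.1 * fderiv ℂ G ((τ : ℂ) * w.1, w.2) (1, 0)) τ := by
    intro τ hτ
    have h1 := ((hball _ (hmem τ hτ)).1.differentiableAt.hasFDerivAt).restrictScalars ℝ
    have h2 : HasDerivAt (fun τ : ℝ => ((τ : ℂ) * w.1, w.2)) ((1 : ℂ) * w.1, (0 : ℂ)) τ :=
      ((Complex.ofRealCLM.hasDerivAt (x := τ)).mul_const w.1).prodMk (hasDerivAt_const _ _)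
    have h3 := h1.comp_hasDerivAt τ h2
    refine h3.congr_deriv ?_
    have : ((1 : ℂ) * w.1, (0 : ℂ)) = w.1 • ((1, 0) : ℂ × ℂ) := by ext <;> simp
    rw [this, ContinuousLinearMap.coe_restrictScalars', map_smul, smul_eq_mul]
  have hcont : ContinuousOn (fun τ : ℝ => w.1 * fderiv ℂ G ((τ : ℂ) * w.1, w.2) (1, 0))
      (Set.uIcc 0 1) := by
    intro τ hτ
    have h1 := ((hball _ (hmem τ hτ)).1.fderiv.continuousAt)
    have h2 : ContinuousAt (fun τ : ℝ => ((τ : ℂ) * w.1, w.2)) τ := by fun_prop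
    have h3 : ContinuousAt (fun τ : ℝ => fderiv ℂ G ((τ : ℂ) * w.1, w.2)) τ :=
      ContinuousAt.comp (f := fun τ : ℝ => ((τ : ℂ) * w.1, w.2)) h1 h2
    exact (continuousAt_const.mul (h3.clm_apply continuousAt_const)).continuousWithinAt
  have hFTC := intervalIntegral.integral_eq_sub_of_hasDerivAt hd hcont.intervalIntegrable
  have hz : G (0, w.2) = 0 := by
    have := hmem 0 (by simp)
    simp only [Complex.ofReal_zero, zero_mul] at this
    exact (hball _ this).2 rfl
  simp only [hTa]
  rw [← intervalIntegral.integral_const_mul, hFTC]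
  simp [hz]

/-- By the inverse function theorem `f`, completed by a linear form `ℓ`, is the first coordinate of
a chart, where Hadamard's lemma applies. -/
theorem exists_analyticAt_eq_mul {E f : ℂ × ℂ → ℂ} {z₀ : ℂ × ℂ} (hE : AnalyticAt ℂ E z₀)
    (hf : AnalyticAt ℂ f z₀) (hf0 : f z₀ = 0) (hdf : fderiv ℂ f z₀ ≠ 0)
    (h : ∀ᶠ z in 𝓝 z₀, f z = 0 → E z = 0) :
    ∃ g : ℂ × ℂ → ℂ, AnalyticAt ℂ g z₀ ∧ ∀ᶠ z in 𝓝 z₀, E z = f z * g z := by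
  obtain ⟨ℓ, hℓ⟩ : ∃ ℓ : ℂ × ℂ →L[ℂ] ℂ,
      Function.Injective ((fderiv ℂ f z₀).prod ℓ) := by
    set m := fderiv ℂ f z₀ with hm
    have hml : ∀ w, m w = w.1 * m (1, 0) + w.2 * m (0, 1) := by
      intro w
      have : w = w.1 • ((1, 0) : ℂ × ℂ) + w.2 • ((0, 1) : ℂ × ℂ) := by ext <;> simp
      conv_lhs => rw [this]
      rw [map_add, map_smul, map_smul, smul_eq_mul, smul_eq_mul]
    by_cases h1 : m (1, 0) = 0
    · have h2 : m (0, 1) ≠ 0 := by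
        intro h2
        apply hdf
        ext <;> simp [h1, h2]
      refine ⟨ContinuousLinearMap.fst ℂ ℂ ℂ, (injective_iff_map_eq_zero _).2 fun w hw => ?_⟩
      simp only [ContinuousLinearMap.prod_apply, Prod.mk_eq_zero, hml w, h1, mul_zero, zero_add,
        mul_eq_zero, h2, or_false, ContinuousLinearMap.coe_fst'] at hw
      exact Prod.ext hw.2 hw.1
    · refine ⟨ContinuousLinearMap.snd ℂ ℂ ℂ, (injective_iff_map_eq_zero _).2 fun w hw => ?_⟩
      simp only [ContinuousLinearMap.prod_apply, Prod.mk_eq_zero, hml w,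
        ContinuousLinearMap.coe_snd'] at hw
      obtain ⟨hw1, hw2⟩ := hw
      simp only [hw2, zero_mul, add_zero, mul_eq_zero, h1, or_false] at hw1
      exact Prod.ext hw1 hw2
  let Ψ : ℂ × ℂ → ℂ × ℂ := fun z => (f z, ℓ (z - z₀))
  have hΨa : AnalyticAt ℂ Ψ z₀ := by
    refine hf.prod ?_
    exact (ℓ.analyticAt _).comp (analyticAt_id.sub analyticAt_const)
  have hΨ0 : Ψ z₀ = 0 := by simp [Ψ, hf0]
  let e : (ℂ × ℂ) ≃L[ℂ] ℂ × ℂ :=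
    (LinearEquiv.ofInjectiveEndo ((fderiv ℂ f z₀).prod ℓ : ℂ × ℂ →ₗ[ℂ] ℂ × ℂ)
      hℓ).toContinuousLinearEquiv
  have hΨd : HasStrictFDerivAt Ψ (e : (ℂ × ℂ) →L[ℂ] ℂ × ℂ) z₀ := by
    have h1 : HasStrictFDerivAt Ψ ((fderiv ℂ f z₀).prod ℓ) z₀ := by
      refine hf.hasStrictFDerivAt.prodMk ?_
      exact ℓ.hasStrictFDerivAt.comp z₀ ((hasStrictFDerivAt_id z₀).sub_const z₀)
    refine h1.congr_fderiv ?_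
    ext <;> rfl
  let Φ := hΨd.toOpenPartialHomeomorph Ψ
  have hΦ : ∀ z, Φ z = Ψ z := fun z => rfl
  have hmem : z₀ ∈ Φ.source := hΨd.mem_toOpenPartialHomeomorph_source
  have hsymm : AnalyticAt ℂ Φ.symm 0 := by
    have := Φ.analyticAt_symm' (i := e) hmem hΨa hΨd.hasFDerivAt.fderiv
    rwa [hΦ, hΨ0] at this
  have hs0 : Φ.symm 0 = z₀ := by
    have := Φ.left_inv hmem
    rwa [hΦ, hΨ0] at this
  have h0t : (0 : ℂ × ℂ) ∈ Φ.target := by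
    have := Φ.map_source hmem
    rwa [hΦ, hΨ0] at this
  have hG : AnalyticAt ℂ (E ∘ Φ.symm) 0 :=
    AnalyticAt.comp (g := E) (f := Φ.symm) (x := 0) (by rwa [hs0]) hsymm
  have hv : ∀ᶠ w in 𝓝 (0 : ℂ × ℂ), w.1 = 0 → (E ∘ Φ.symm) w = 0 := by
    have hc : Filter.Tendsto Φ.symm (𝓝 0) (𝓝 z₀) := by
      have := hsymm.continuousAt.tendsto
      rwa [hs0] at this
    filter_upwards [hc.eventually h, Φ.open_target.mem_nhds h0t] with w hw hwt hw1
    refine hw ?_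
    have h3 : Ψ (Φ.symm w) = w := Φ.right_inv hwt
    rw [← hw1]
    exact congrArg Prod.fst h3
  obtain ⟨H, hH, hHe⟩ := exists_analyticAt_eq_fst_mul hG hv
  refine ⟨H ∘ Ψ, AnalyticAt.comp (by rwa [hΨ0]) hΨa, ?_⟩
  have hc : Filter.Tendsto Ψ (𝓝 z₀) (𝓝 0) := by
    have := hΨa.continuousAt.tendsto
    rwa [hΨ0] at this
  filter_upwards [hc.eventually hHe, Φ.open_source.mem_nhds hmem] with z hz hzs
  have h3 : Φ.symm (Ψ z) = z := Φ.left_inv hzs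
  rwa [Function.comp_apply, h3] at hz

theorem frequently_ne_zero_of_fderiv_ne_zero {f : ℂ × ℂ → ℂ} {z : ℂ × ℂ}
    (hdf : fderiv ℂ f z ≠ 0) : ∃ᶠ y in 𝓝 z, f y ≠ 0 := by
  intro h
  refine hdf ?_
  have : f =ᶠ[𝓝 z] fun _ => 0 := by
    filter_upwards [h] with y hy
    exact not_not.1 hy
  rw [this.fderiv_eq]
  simp

theorem eventually_fderiv_ne_zero {f : ℂ × ℂ → ℂ} {z₀ : ℂ × ℂ} (hf : AnalyticAt ℂ f z₀)
    (hdf : fderiv ℂ f z₀ ≠ 0) : ∀ᶠ z in 𝓝 z₀, fderiv ℂ f z ≠ 0 :=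
  hf.fderiv.continuousAt.eventually_ne hdf

/-- Divide by `f` once and induct: the quotient satisfies the bound of exponent `n` where `f ≠ 0`,
and then everywhere by continuity, the zeros of `f` having empty interior. -/
theorem exists_analyticAt_eq_pow_mul {E f : ℂ × ℂ → ℂ} {z₀ : ℂ × ℂ} (hE : AnalyticAt ℂ E z₀)
    (hf : AnalyticAt ℂ f z₀) (hf0 : f z₀ = 0) (hdf : fderiv ℂ f z₀ ≠ 0) (n : ℕ) (M : ℝ)
    (h : ∀ᶠ z in 𝓝 z₀, ‖E z‖ ≤ M * ‖f z‖ ^ n) :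
    ∃ g : ℂ × ℂ → ℂ, AnalyticAt ℂ g z₀ ∧ ∀ᶠ z in 𝓝 z₀, E z = f z ^ n * g z := by
  induction n generalizing E with
  | zero => exact ⟨E, hE, by simp⟩
  | succ n ih =>
    have h0 : ∀ᶠ z in 𝓝 z₀, f z = 0 → E z = 0 := by
      filter_upwards [h] with z hz hfz
      simpa [hfz] using hz
    obtain ⟨g, hg, hgE⟩ := exists_analyticAt_eq_mul hE hf hf0 hdf h0
    have hb : ∀ᶠ z in 𝓝 z₀, f z ≠ 0 → ‖g z‖ ≤ M * ‖f z‖ ^ n := by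
      filter_upwards [h, hgE] with z hz hgz hfz
      rw [hgz, norm_mul, pow_succ, ← mul_assoc, mul_comm] at hz
      exact le_of_mul_le_mul_right hz (norm_pos_iff.2 hfz)
    have hb' : ∀ᶠ z in 𝓝 z₀, ‖g z‖ ≤ M * ‖f z‖ ^ n := by
      filter_upwards [hb.eventually_nhds, hf.eventually_analyticAt, hg.eventually_analyticAt,
        eventually_fderiv_ne_zero hf hdf] with z hz hfz hgz hdz
      refine le_of_tendsto_of_tendsto_of_frequently hgz.continuousAt.norm
        ((hfz.continuousAt.norm.pow n).const_mul M) ?_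
      exact (frequently_ne_zero_of_fderiv_ne_zero hdz).mp (hz.mono fun y hy hy' => hy hy')
    obtain ⟨g', hg', hgg'⟩ := ih hg hb'
    refine ⟨g', hg', ?_⟩
    filter_upwards [hgE, hgg'] with z h1 h2
    rw [h1, h2]; ring

theorem eventually_eq_zero_of_forall_isBigO {a : ℂ × ℂ → ℂ} {z₀ : ℂ × ℂ}
    (ha : AnalyticAt ℂ a z₀)
    (h : ∀ m : ℕ, (fun y => a (z₀ + y)) =O[𝓝 0] fun y => ‖y‖ ^ m) : ∀ᶠ z in 𝓝 z₀, a z = 0 := by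
  obtain ⟨p, hp⟩ := ha
  have hp0 : ∀ n y, p n (fun _ => y) = 0 := by
    intro n
    induction n using Nat.strong_induction_on with
    | _ n ih =>
      have h1 := hp.isBigO_sub_partialSum_pow (n + 1)
      have h2 := (h (n + 1)).sub h1
      have h3 : (fun y => p n fun _ => y) =O[𝓝 0] fun y => ‖y‖ ^ (n + 1) := by
        refine h2.congr_left fun y => ?_
        rw [FormalMultilinearSeries.partialSum, Finset.sum_range_succ,
          Finset.sum_eq_zero fun m hm => ih m (Finset.mem_range.1 hm) y]
        simp
      exact h3.continuousMultilinearMap_apply_eq_zero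
  filter_upwards [hp.eventually_hasSum_sub] with z hz
  simp only [hp0] at hz
  exact hz.unique hasSum_zero

theorem analyticAt_isBigO_of_eq_zero {f : ℂ × ℂ → ℂ} {z₀ : ℂ × ℂ} (hf : AnalyticAt ℂ f z₀)
    (hf0 : f z₀ = 0) : (fun y => f (z₀ + y)) =O[𝓝 0] fun y => ‖y‖ := by
  have h1 := hf.differentiableAt.isBigO_sub
  have h2 : Filter.Tendsto (fun y => z₀ + y) (𝓝 0) (𝓝 z₀) := by
    have : Continuous fun y => z₀ + y := by fun_prop
    simpa using this.tendsto 0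
  have h3 := h1.comp_tendsto h2
  simp only [Function.comp_def, hf0, sub_zero, add_sub_cancel_left] at h3
  exact h3.norm_right

/-- Either all the functions `a i` vanish near `z₀`, or they have a well defined generic order
along the curve `f = 0`. -/
theorem exists_order_along {ι : Type*} [Finite ι] {a : ι → ℂ × ℂ → ℂ} {f : ℂ × ℂ → ℂ}
    {z₀ : ℂ × ℂ} (ha : ∀ i, AnalyticAt ℂ (a i) z₀) (hf : AnalyticAt ℂ f z₀) (hf0 : f z₀ = 0)
    (hdf : fderiv ℂ f z₀ ≠ 0) :
    (∀ᶠ z in 𝓝 z₀, ∀ i, a i z = 0) ∨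
      ∃ (m : ℕ) (b : ι → ℂ × ℂ → ℂ), (∀ i, AnalyticAt ℂ (b i) z₀) ∧
        (∀ᶠ z in 𝓝 z₀, ∀ i, a i z = f z ^ m * b i z) ∧
          ∃ᶠ z in 𝓝 z₀, f z = 0 ∧ ∃ i, b i z ≠ 0 := by
  by_cases H : ∃ (m : ℕ) (b : ι → ℂ × ℂ → ℂ), (∀ i, AnalyticAt ℂ (b i) z₀) ∧
        (∀ᶠ z in 𝓝 z₀, ∀ i, a i z = f z ^ m * b i z) ∧
          ∃ᶠ z in 𝓝 z₀, f z = 0 ∧ ∃ i, b i z ≠ 0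
  · exact Or.inr H
  left
  -- If no order exists, division by `f` never stops, so each `a i` is `O(‖y‖ ^ m)` for every `m`
  -- and its Taylor series is zero.
  have key : ∀ m : ℕ, ∃ b : ι → ℂ × ℂ → ℂ, (∀ i, AnalyticAt ℂ (b i) z₀) ∧
      ∀ᶠ z in 𝓝 z₀, ∀ i, a i z = f z ^ m * b i z := by
    intro m
    induction m with
    | zero => exact ⟨a, ha, by simp⟩
    | succ m ih =>
      obtain ⟨b, hb, hab⟩ := ih
      have hnot : ∀ᶠ z in 𝓝 z₀, ¬(f z = 0 ∧ ∃ i, b i z ≠ 0) := by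
        by_contra hfreq
        exact H ⟨m, b, hb, hab, hfreq⟩
      have hdiv : ∀ i, ∃ g : ℂ × ℂ → ℂ, AnalyticAt ℂ g z₀ ∧ ∀ᶠ z in 𝓝 z₀, b i z = f z * g z := by
        intro i
        refine exists_analyticAt_eq_mul (hb i) hf hf0 hdf ?_
        filter_upwards [hnot] with z hz hfz
        by_contra hne
        exact hz ⟨hfz, i, hne⟩
      choose g hg hbg using hdiv
      refine ⟨g, hg, ?_⟩
      filter_upwards [hab, Filter.eventually_all.2 hbg] with z h1 h2 i
      rw [h1, h2]; ring
  rw [Filter.eventually_all]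
  intro i
  refine eventually_eq_zero_of_forall_isBigO (ha i) fun m => ?_
  obtain ⟨b, hb, hab⟩ := key m
  have h2 : Filter.Tendsto (fun y => z₀ + y) (𝓝 0) (𝓝 z₀) := by
    have : Continuous fun y => z₀ + y := by fun_prop
    simpa using this.tendsto 0
  have h3 : (fun y => b i (z₀ + y)) =O[𝓝 0] fun _ => (1 : ℝ) :=
    Filter.Tendsto.isBigO_one ℝ ((hb i).continuousAt.tendsto.comp h2)
  have h4 := ((analyticAt_isBigO_of_eq_zero hf hf0).pow m).mul h3
  simp only [mul_one] at h4
  refine h4.congr' ?_ (Filter.EventuallyEq.refl _ _)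
  filter_upwards [h2.eventually hab] with y hy
  exact (hy i).symm

/-! ## Rescaling a vector field -/

/-- Iterated derivatives along `w`, the `i`-th derivative being rescaled by `c i`. -/
noncomputable def scaledIterLie (w : ℂ × ℂ → ℂ × ℂ) (c : ℕ → ℂ × ℂ → ℂ) :
    ℕ → (ℂ × ℂ → ℂ) → (ℂ × ℂ → ℂ)
  | 0, g => g
  | j + 1, g => fun z => c j z * fderiv ℂ (scaledIterLie w c j g) z (w z)

/-- Leibniz rule. The coefficients `t l` do not depend on `g`, so rescaling multiplies the Wronskian
matrix on the left by a lower triangular matrix whose diagonal is known. -/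
theorem exists_scaledIterLie_eq_sum {w : ℂ × ℂ → ℂ × ℂ} {c : ℕ → ℂ × ℂ → ℂ} {z : ℂ × ℂ}
    (hw : AnalyticAt ℂ w z) (hc : ∀ i, AnalyticAt ℂ (c i) z) (i : ℕ) :
    ∃ t : ℕ → ℂ × ℂ → ℂ, (∀ l, AnalyticAt ℂ (t l) z) ∧ (∀ l, i < l → t l = 0) ∧
      t i =ᶠ[𝓝 z] (fun y => ∏ l ∈ Finset.range i, c l y) ∧
      ∀ g : ℂ × ℂ → ℂ, AnalyticAt ℂ g z →
        scaledIterLie w c i g =ᶠ[𝓝 z]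
          fun y => ∑ l ∈ Finset.range (i + 1), t l y * iterLie w l g y := by
  induction i with
  | zero =>
    refine ⟨fun l => if l = 0 then fun _ => 1 else 0, ?_, ?_, ?_, ?_⟩
    · intro l
      by_cases h : l = 0
      · simpa [h] using analyticAt_const
      · simp only [h, if_false]
        exact analyticAt_const
    · intro l hl
      simp [hl.ne']
    · simp
    · intro g _
      simp [scaledIterLie, iterLie]
  | succ i ih =>
    obtain ⟨t, ht, ht0, hti, htg⟩ := ih
    have hlie : ∀ l, AnalyticAt ℂ (fun y => fderiv ℂ (t l) y (w y)) z :=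
      fun l => analyticAt_iterLie hw (ht l) 1
    refine ⟨fun l y => c i y * (fderiv ℂ (t l) y (w y) + (if l = 0 then 0 else t (l - 1) y)),
      ?_, ?_, ?_, ?_⟩
    · intro l
      refine (hc i).mul ((hlie l).add ?_)
      by_cases h : l = 0
      · simpa [h] using analyticAt_const
      · simpa [h] using ht (l - 1)
    · intro l hl
      ext y
      have h1 : t l = 0 := ht0 l (by omega)
      have h2 : t (l - 1) = 0 := ht0 (l - 1) (by omega)
      have h3 : fderiv ℂ (0 : ℂ × ℂ → ℂ) y = 0 := by
        rw [show (0 : ℂ × ℂ → ℂ) = fun _ => 0 from rfl]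
        simp
      simp [h1, h2, h3]
    · filter_upwards [hti] with y hy
      have h1 : t (i + 1) = 0 := ht0 _ (by omega)
      have h3 : fderiv ℂ (0 : ℂ × ℂ → ℂ) y = 0 := by
        rw [show (0 : ℂ × ℂ → ℂ) = fun _ => 0 from rfl]
        simp
      simp [h1, h3, hy, Finset.prod_range_succ, mul_comm]
    · intro g hg
      have hA : ∀ᶠ y in 𝓝 z, ∀ l ∈ Finset.range (i + 1), AnalyticAt ℂ (t l) y ∧
          AnalyticAt ℂ (iterLie w l g) y := by
        rw [Filter.eventually_all_finset]
        intro l _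
        exact (ht l).eventually_analyticAt.and (analyticAt_iterLie hw hg l).eventually_analyticAt
      filter_upwards [(htg g hg).eventuallyEq_nhds, hA] with y hy hyA
      have hd : HasFDerivAt (fun y => ∑ l ∈ Finset.range (i + 1), t l y * iterLie w l g y)
          (∑ l ∈ Finset.range (i + 1), (t l y • fderiv ℂ (iterLie w l g) y +
            iterLie w l g y • fderiv ℂ (t l) y)) y :=
        HasFDerivAt.fun_sum fun l hl => (hyA l hl).1.differentiableAt.hasFDerivAt.mul
          (hyA l hl).2.differentiableAt.hasFDerivAt
      change c i y * fderiv ℂ (scaledIterLie w c i g) y (w y) = _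
      rw [hy.fderiv_eq, hd.fderiv]
      simp only [sum_apply, add_apply,
        smul_apply, smul_eq_mul]
      have h1 : t (i + 1) = 0 := ht0 _ (by omega)
      have h3 : fderiv ℂ (0 : ℂ × ℂ → ℂ) y = 0 := by
        rw [show (0 : ℂ × ℂ → ℂ) = fun _ => 0 from rfl]
        simp
      have e1 : ∑ l ∈ Finset.range (i + 1 + 1), c i y * (fderiv ℂ (t l) y (w y) +
            (if l = 0 then 0 else t (l - 1) y)) * iterLie w l g y =
          c i y * (∑ l ∈ Finset.range (i + 1 + 1), fderiv ℂ (t l) y (w y) * iterLie w l g y +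
            ∑ l ∈ Finset.range (i + 1 + 1),
              (if l = 0 then 0 else t (l - 1) y) * iterLie w l g y) := by
        rw [← Finset.sum_add_distrib, Finset.mul_sum]
        exact Finset.sum_congr rfl fun l _ => by ring
      rw [e1, Finset.sum_range_succ _ (i + 1), Finset.sum_range_succ' _ (i + 1), h1, h3,
        Finset.sum_add_distrib]
      simp only [zero_apply, zero_mul, add_zero, if_true, Nat.add_sub_cancel,
        Nat.succ_ne_zero, if_false]
      rw [add_comm]
      congr 2
      exact Finset.sum_congr rfl fun l _ => mul_comm _ _

theorem det_scaledIterLie {k : ℕ} {w : ℂ × ℂ → ℂ × ℂ} {c : ℕ → ℂ × ℂ → ℂ} {z : ℂ × ℂ}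
    {g : Fin (k + 1) → ℂ × ℂ → ℂ} (hw : AnalyticAt ℂ w z) (hc : ∀ i, AnalyticAt ℂ (c i) z)
    (hg : ∀ j, AnalyticAt ℂ (g j) z) :
    Matrix.det (Matrix.of fun i j : Fin (k + 1) => scaledIterLie w c (i : ℕ) (g j) z) =
      (∏ i ∈ Finset.range (k + 1), ∏ l ∈ Finset.range i, c l z) * action g w z := by
  choose t ht ht0 hti htg using exists_scaledIterLie_eq_sum hw hc
  let T : Matrix (Fin (k + 1)) (Fin (k + 1)) ℂ := Matrix.of fun i l => t i l z
  have hT : (Matrix.of fun i j : Fin (k + 1) => scaledIterLie w c (i : ℕ) (g j) z) =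
      T * Matrix.of fun i j : Fin (k + 1) => iterLie w (i : ℕ) (g j) z := by
    ext i j
    rw [Matrix.mul_apply, Matrix.of_apply, (htg i (g j) (hg j)).self_of_nhds]
    simp only [T, Matrix.of_apply]
    rw [Fin.sum_univ_eq_sum_range (fun l => t i l z * iterLie w l (g j) z) (k + 1)]
    refine Finset.sum_subset (fun l hl => ?_) fun l _ hl => ?_
    · simp only [Finset.mem_range] at hl ⊢
      omega
    · rw [ht0 i l (by simpa using hl)]
      simp
  rw [hT, Matrix.det_mul, Matrix.det_of_isLowerTriangular T]
  · rw [action, ← Fin.prod_univ_eq_prod_range]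
    congr 1
    exact Finset.prod_congr rfl fun i _ => (hti i).self_of_nhds
  · intro i l hil
    have hil' : (i : ℕ) < l := hil
    simp [T, ht0 i l hil']

theorem action_smul {k : ℕ} {w : ℂ × ℂ → ℂ × ℂ} {ρ : ℂ × ℂ → ℂ} {z : ℂ × ℂ}
    {g : Fin (k + 1) → ℂ × ℂ → ℂ} (hw : AnalyticAt ℂ w z) (hρ : AnalyticAt ℂ ρ z)
    (hg : ∀ j, AnalyticAt ℂ (g j) z) :
    action g (fun y => ρ y • w y) z = ρ z ^ ((k + 1) * k / 2) * action g w z := by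
  have h := det_scaledIterLie (c := fun _ => ρ) hw (fun _ => hρ) hg
  simp only [Finset.prod_const, Finset.card_range] at h
  rw [Finset.prod_pow_eq_pow_sum (Finset.range (k + 1)) (fun i => i) (ρ z), Finset.sum_range_id,
    Nat.add_sub_cancel] at h
  rw [← h, action]
  have e : ∀ (i : ℕ) (f : ℂ × ℂ → ℂ),
      iterLie (fun y => ρ y • w y) i f = scaledIterLie w (fun _ => ρ) i f := by
    intro i f
    induction i with
    | zero => rfl
    | succ i ih =>
      ext y
      simp only [iterLie, scaledIterLie, ih, map_smul, smul_eq_mul]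
  simp only [e]

theorem action_congr {k : ℕ} {w w' : ℂ × ℂ → ℂ × ℂ} {z : ℂ × ℂ} (h : w =ᶠ[𝓝 z] w')
    (g : Fin (k + 1) → ℂ × ℂ → ℂ) : action g w z = action g w' z := by
  have e : ∀ (i : ℕ) (f : ℂ × ℂ → ℂ), iterLie w i f =ᶠ[𝓝 z] iterLie w' i f := by
    intro i f
    induction i with
    | zero => rfl
    | succ i ih =>
      filter_upwards [ih.eventuallyEq_nhds, h] with y h1 h2
      simp only [iterLie, h1.fderiv_eq, h2]
  unfold action
  congr 1
  ext i j
  exact (e i (g j)).self_of_nhds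

theorem action_eq_zero {k : ℕ} (hk : 1 ≤ k) {w : ℂ × ℂ → ℂ × ℂ} {z : ℂ × ℂ} (h : w z = 0)
    (g : Fin (k + 1) → ℂ × ℂ → ℂ) : action g w z = 0 := by
  refine Matrix.det_eq_zero_of_row_eq_zero (⟨1, by omega⟩ : Fin (k + 1)) fun j => ?_
  simp [iterLie, h]

/-- Row `i` has been rescaled `i` times, the first time by 1; it therefore contributes `θ ^ (i -
1)`, and nothing for `i = 0`, where the subtraction truncates. -/
theorem prod_range_prod_ite {M : Type*} [CommMonoid M] (k : ℕ) (θ : M) :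
    ∏ i ∈ Finset.range (k + 1), ∏ l ∈ Finset.range i, (if l = 0 then 1 else θ) =
      θ ^ (k * (k - 1) / 2) := by
  have h : ∀ i, ∏ l ∈ Finset.range i, (if l = 0 then 1 else θ) = θ ^ (i - 1) := by
    intro i
    cases i with
    | zero => simp
    | succ i => simp [Finset.prod_range_succ']
  simp only [h, Finset.prod_pow_eq_pow_sum]
  rw [Finset.sum_range_succ', ← Finset.sum_range_id]
  simp

/-! ## Derivations of polynomial rings -/

open Polynomial

section Algebra

variable {R : Type*} [CommRing R] [Algebra ℂ R]

/-- The derivation of `R[X]` acting on the coefficients through `δ` and killing `X`. -/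
noncomputable def coeffDer (δ : Derivation ℂ R R) : Derivation ℂ R[X] R[X] :=
  PolynomialModule.equivPolynomialSelf.toLinearMap.compDer δ.mapCoeffs

theorem coeffDer_monomial (δ : Derivation ℂ R R) (n : ℕ) (a : R) :
    coeffDer δ (monomial n a) = monomial n (δ a) := by
  simp [coeffDer]

theorem coeffDer_C (δ : Derivation ℂ R R) (a : R) : coeffDer δ (C a) = C (δ a) := by
  rw [← monomial_zero_left, coeffDer_monomial, monomial_zero_left]

theorem coeffDer_X (δ : Derivation ℂ R R) : coeffDer δ X = 0 := by
  rw [← monomial_one_one_eq_X, coeffDer_monomial]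
  simp

/-- The derivation `δA + X δB`. -/
noncomputable def slopeDer (δA δB : Derivation ℂ R R) : Derivation ℂ R[X] R[X] :=
  coeffDer δA + (X : R[X]) • coeffDer δB

theorem slopeDer_C (δA δB : Derivation ℂ R R) (a : R) :
    slopeDer δA δB (C a) = C (δA a) + X * C (δB a) := by
  simp [slopeDer, coeffDer_C]

theorem slopeDer_X (δA δB : Derivation ℂ R R) : slopeDer δA δB X = 0 := by
  simp [slopeDer, coeffDer_X]

/-- The derivation of `R[X]` which is tangent to `P = 0` and lifts `P' (δA + X δB)`. -/
noncomputable def webDer (δA δB : Derivation ℂ R R) (P : R[X]) : Derivation ℂ R[X] R[X] :=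
  derivative P • slopeDer δA δB - slopeDer δA δB P • (derivative'.restrictScalars ℂ)

theorem webDer_apply (δA δB : Derivation ℂ R R) (P p : R[X]) :
    webDer δA δB P p = derivative P * slopeDer δA δB p - slopeDer δA δB P * derivative p := rfl

/-- The rows `g, w g, w' w g, w' w' w g, …` with `w = δA + X δB` and `w' = webDer`. -/
noncomputable def webRow (δA δB : Derivation ℂ R R) (P : R[X]) : ℕ → R → R[X]
  | 0, g => C g
  | i + 1, g => (webDer δA δB P)^[i] (slopeDer δA δB (C g))

/-- The determinant of the matrix of rows `webRow`. -/
noncomputable def webDet (δA δB : Derivation ℂ R R) (P : R[X]) {k : ℕ} (g : Fin (k + 1) → R) :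
    R[X] :=
  Matrix.det (Matrix.of fun i j : Fin (k + 1) => webRow δA δB P (i : ℕ) (g j))

theorem derivation_mem_span {S : Type*} [CommRing S] [Algebra ℂ S] (D : Derivation ℂ S S)
    {s : Set S} (h : ∀ x ∈ s, D x ∈ Ideal.span s) {p : S} (hp : p ∈ Ideal.span s) :
    D p ∈ Ideal.span s := by
  induction hp using Submodule.span_induction with
  | mem x hx => exact h x hx
  | zero => simp
  | add x y _ _ hx hy => rw [map_add]; exact add_mem hx hy
  | smul a x hx hDx =>
    rw [smul_eq_mul, D.leibniz, smul_eq_mul, smul_eq_mul]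
    exact add_mem (Ideal.mul_mem_left _ _ hDx) (Ideal.mul_mem_right _ _ hx)

theorem webRow_linear (δA δB : Derivation ℂ R R) (P : R[X]) (i : ℕ) {ι : Type*} (s : Finset ι)
    (c : ι → ℂ) (g : ι → R) :
    webRow δA δB P i (∑ j ∈ s, c j • g j) = ∑ j ∈ s, c j • webRow δA δB P i (g j) := by
  have hC : (C (∑ j ∈ s, c j • g j) : R[X]) = ∑ j ∈ s, c j • C (g j) := by
    rw [map_sum]
    exact Finset.sum_congr rfl fun j _ => (smul_C _ _).symm
  cases i with
  | zero => exact hC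
  | succ i =>
    simp only [webRow]
    rw [hC, map_sum]
    simp only [Derivation.map_smul]
    induction i with
    | zero => rfl
    | succ i ih => simp only [Function.iterate_succ_apply', ih, map_sum, Derivation.map_smul]

/-- Each term of the permutation expansion contains one factor from every column in `T`. -/
theorem det_mem_pow_of_columns {S ι : Type*} [CommRing S] [Fintype ι] [DecidableEq ι]
    (I : Ideal S) (M : Matrix ι ι S) (T : Finset ι) (h : ∀ j ∈ T, ∀ i, M i j ∈ I) :
    M.det ∈ I ^ T.card := by
  rw [Matrix.det_apply]
  refine sum_mem fun σ _ => ?_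
  refine Submodule.smul_of_tower_mem _ _ ?_
  rw [← Finset.prod_mul_prod_compl T]
  refine Ideal.mul_mem_right _ _ ?_
  rw [← Finset.prod_const]
  exact Ideal.prod_mem_prod fun j hj => h j hj _

/-- If the columns of `M` combined along the vectors of an `n`-dimensional subspace have entries
in `I`, then `det M ∈ I ^ n`. -/
theorem det_mem_pow_of_submodule {S : Type*} [CommRing S] [Algebra ℂ S] {k : ℕ} (I : Ideal S)
    (M : Matrix (Fin (k + 1)) (Fin (k + 1)) S) (V : Submodule ℂ (Fin (k + 1) → ℂ))
    (h : ∀ c ∈ V, ∀ i, ∑ j, c j • M i j ∈ I) : M.det ∈ I ^ Module.finrank ℂ V := by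
  -- A basis adapted to `V`: the base change is invertible over `ℂ`, so it alters the determinant by
  -- a unit, and the columns indexed by the basis of `V` now lie in `I`.
  let b := Module.Basis.sumQuot (Module.finBasis ℂ V) (Module.finBasis ℂ ((Fin (k + 1) → ℂ) ⧸ V))
  have e := b.indexEquiv (Pi.basisFun ℂ (Fin (k + 1)))
  let b' := b.reindex e
  let Q : Matrix (Fin (k + 1)) (Fin (k + 1)) ℂ := (Pi.basisFun ℂ (Fin (k + 1))).toMatrix b'
  let QS : Matrix (Fin (k + 1)) (Fin (k + 1)) S := Q.map (algebraMap ℂ S)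
  have hQ : IsUnit QS.det := by
    have h1 : IsUnit Q.det := by
      have := (Pi.basisFun ℂ (Fin (k + 1))).isUnit_det b'
      rwa [Module.Basis.det_apply] at this
    have h2 := h1.map (algebraMap ℂ S)
    rwa [RingHom.map_det] at h2
  let T : Finset (Fin (k + 1)) :=
    Finset.univ.map ((Function.Embedding.inl).trans e.toEmbedding)
  have hT : T.card = Module.finrank ℂ V := by simp [T]
  have hmul : (M * QS).det ∈ I ^ T.card := by
    refine det_mem_pow_of_columns I _ T fun j hj i => ?_
    simp only [T, Finset.mem_map, Finset.mem_univ, true_and] at hj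
    obtain ⟨l, rfl⟩ := hj
    rw [Matrix.mul_apply]
    have h3 := h (b (Sum.inl l)) (by simp [b]) i
    convert h3 using 2 with j _
    simp [QS, Q, b', Module.Basis.toMatrix_apply, Algebra.smul_def, mul_comm]
  rw [Matrix.det_mul, hT] at hmul
  exact (Ideal.mul_unit_mem_iff_mem _ hQ).1 hmul

end Algebra

/-! ### Stability of the ideal of the lifted curve -/

section Invariant

variable {R : Type*} [CommRing R] [Algebra ℂ R]

theorem derivation_eval (δ : Derivation ℂ R R) (p : R[X]) (c : R) :
    δ (p.eval c) = (coeffDer δ p).eval c + (derivative p).eval c * δ c := by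
  induction p using Polynomial.induction_on' with
  | add p q hp hq => simp only [eval_add, map_add, hp, hq]; ring
  | monomial n a =>
    simp only [eval_monomial, coeffDer_monomial, derivative_monomial, Derivation.leibniz,
      Derivation.leibniz_pow, smul_eq_mul, nsmul_eq_mul]
    ring

omit [Algebra ℂ R] in
theorem mem_span_pair_of_eval {p : R[X]} {f c : R} (h : f ∣ p.eval c) :
    p ∈ Ideal.span {C f, X - C c} := by
  obtain ⟨q, hq⟩ := X_sub_C_dvd_sub_C_eval (a := c) (p := p)
  obtain ⟨r, hr⟩ := h
  rw [Ideal.mem_span_pair]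
  refine ⟨C r, q, ?_⟩
  rw [← sub_eq_iff_eq_add.1 hq |>.symm, hr, C_mul]
  ring

/-- It suffices to test the generators at `X = c`. The image of `f` becomes a multiple of `(δA + c
δB) f = 0`, by tangency. The image of `X - c` becomes `-(δA + c δB)(P(c))`, and this derivative of
`f * r` is divisible by `f`, again by tangency. -/
theorem webDer_mem_span {δA δB : Derivation ℂ R R} {P : R[X]} {f c r : R}
    (hP : P.eval c = f * r) (hf : δA f = -c * δB f) {p : R[X]}
    (hp : p ∈ Ideal.span {C f, X - C c}) :
    webDer δA δB P p ∈ Ideal.span {C f, X - C c} := by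
  refine derivation_mem_span _ ?_ hp
  rintro x (rfl | rfl)
  · refine mem_span_pair_of_eval ?_
    refine ⟨0, ?_⟩
    simp only [webDer_apply, slopeDer_C, hf, derivative_C, mul_zero, sub_zero, eval_mul, eval_add,
      eval_C, eval_X]
    ring
  · refine mem_span_pair_of_eval ?_
    have hA := derivation_eval δA P c
    have hB := derivation_eval δB P c
    rw [hP, Derivation.leibniz, smul_eq_mul, smul_eq_mul] at hA hB
    refine ⟨-(δA r + c * δB r), ?_⟩
    have hS : (slopeDer δA δB P).eval c =
        (coeffDer δA P).eval c + c * (coeffDer δB P).eval c := by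
      simp [slopeDer]
    simp only [webDer_apply, map_sub, slopeDer_C, slopeDer_X, derivative_X, derivative_C,
      eval_sub, eval_mul, eval_zero, eval_add, eval_C, eval_X, eval_one, hS]
    rw [hf] at hA
    linear_combination hA + c * hB

theorem webRow_mem_span {δA δB : Derivation ℂ R R} {P : R[X]} {f c r : R}
    (hP : P.eval c = f * r) (hf : δA f = -c * δB f) (g : R) (i : ℕ) :
    webRow δA δB P i (f * g) ∈ Ideal.span {C f, X - C c} := by
  cases i with
  | zero =>
    refine mem_span_pair_of_eval ?_
    simp [webRow]
  | succ i =>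
    simp only [webRow]
    induction i with
    | zero =>
      refine mem_span_pair_of_eval ?_
      refine ⟨δA g + c * δB g, ?_⟩
      simp only [Function.iterate_zero, id, slopeDer_C, Derivation.leibniz, smul_eq_mul, hf,
        eval_add, eval_C, eval_mul, eval_X]
      ring
    | succ i ih =>
      rw [Function.iterate_succ_apply']
      exact webDer_mem_span hP hf ih

theorem webDet_mem_span_pow {δA δB : Derivation ℂ R R} {P : R[X]} {f c r : R}
    (hP : P.eval c = f * r) (hf : δA f = -c * δB f) {k : ℕ} (g : Fin (k + 1) → R)
    (V : Submodule ℂ (Fin (k + 1) → ℂ)) (hV : ∀ a ∈ V, f ∣ ∑ j, a j • g j) :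
    webDet δA δB P g ∈ Ideal.span {C f, X - C c} ^ Module.finrank ℂ V := by
  refine det_mem_pow_of_submodule _ _ V fun a ha i => ?_
  obtain ⟨g', hg'⟩ := hV a ha
  simp only [Matrix.of_apply]
  rw [← webRow_linear, hg']
  exact webRow_mem_span hP hf g' i

/-- Only row 0 is used: it consists of the functions `g j` themselves. -/
theorem C_dvd_webDet {δA δB : Derivation ℂ R R} {P : R[X]} {f : R} {k : ℕ}
    {g : Fin (k + 1) → R} (h : ∀ j, f ∣ g j) : C f ∣ webDet δA δB P g := by
  rw [← Ideal.mem_span_singleton, webDet, ← Matrix.det_transpose]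
  have := det_mem_pow_of_columns (Ideal.span {C f})
    (Matrix.of fun i j : Fin (k + 1) => webRow δA δB P (i : ℕ) (g j)).transpose {0} ?_
  · simpa using this
  · intro j hj i
    rw [Finset.mem_singleton] at hj
    subst hj
    rw [Ideal.mem_span_singleton]
    obtain ⟨q, hq⟩ := h i
    exact ⟨C q, by simp [webRow, hq]⟩

end Invariant

/-! ## Rings of holomorphic functions -/

/-- The functions which are holomorphic on `U`. -/
def holo (U : Set (ℂ × ℂ)) : Subalgebra ℂ (ℂ × ℂ → ℂ) where
  carrier := {a | AnalyticOnNhd ℂ a U}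
  mul_mem' ha hb := AnalyticOnNhd.mul ha hb
  add_mem' ha hb := AnalyticOnNhd.add ha hb
  algebraMap_mem' _ := analyticOnNhd_const

open Classical in
/-- The derivative in the direction `v` as a derivation of the ring of functions holomorphic on
`U`. -/
noncomputable def dirDer {U : Set (ℂ × ℂ)} (hU : IsOpen U) (v : ℂ × ℂ) :
    Derivation ℂ (holo U) (holo U) where
  -- Elements of `holo U` are functions on all of `ℂ²`, arbitrary off `U`, and the laws of a
  -- derivation must hold there too; the value 0 ensures this.
  toFun a := ⟨fun z => if z ∈ U then fderiv ℂ (a : ℂ × ℂ → ℂ) z v else 0, by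
    intro z hz
    have h1 : AnalyticAt ℂ (fun z => fderiv ℂ (a : ℂ × ℂ → ℂ) z v) z :=
      ((ContinuousLinearMap.apply ℂ ℂ v).analyticAt _).comp (a.2 z hz).fderiv
    refine h1.congr ?_
    filter_upwards [hU.mem_nhds hz] with y hy
    simp [hy]⟩
  map_add' a b := by
    ext z
    by_cases hz : z ∈ U
    · have := fderiv_add (a.2 z hz).differentiableAt (b.2 z hz).differentiableAt
      simp [hz, this]
    · simp [hz]
  map_smul' t a := by
    ext z
    by_cases hz : z ∈ U
    · have := fderiv_const_smul (a.2 z hz).differentiableAt t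
      simp [hz, this]
    · simp [hz]
  map_one_eq_zero' := by
    ext z
    simp
  leibniz' a b := by
    ext z
    by_cases hz : z ∈ U
    · have := fderiv_mul (a.2 z hz).differentiableAt (b.2 z hz).differentiableAt
      simp [hz, this]
    · simp [hz]

theorem dirDer_apply {U : Set (ℂ × ℂ)} (hU : IsOpen U) (v : ℂ × ℂ) (a : holo U) {z : ℂ × ℂ}
    (hz : z ∈ U) : (dirDer hU v a : ℂ × ℂ → ℂ) z = fderiv ℂ (a : ℂ × ℂ → ℂ) z v := by
  classical
  exact if_pos hz

/-- Evaluation at a point. -/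
def evalAt (U : Set (ℂ × ℂ)) (z : ℂ × ℂ) : holo U →+* ℂ :=
  (Pi.evalRingHom (fun _ => ℂ) z).comp (holo U).val.toRingHom

theorem evalAt_apply (U : Set (ℂ × ℂ)) (z : ℂ × ℂ) (a : holo U) :
    evalAt U z a = (a : ℂ × ℂ → ℂ) z := rfl

/-! ### Polynomials evaluated along a branch of slopes -/

section Slope

variable {U : Set (ℂ × ℂ)} {s : ℂ × ℂ → ℂ} {z : ℂ × ℂ}

theorem analyticAt_eval₂ (hz : z ∈ U) (hs : AnalyticAt ℂ s z) (p : (holo U)[X]) :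
    AnalyticAt ℂ (fun y => p.eval₂ (evalAt U y) (s y)) z := by
  simp only [eval₂_eq_sum_range]
  refine Finset.analyticAt_fun_sum _ fun i _ => ?_
  exact ((p.coeff i).2 z hz).mul (hs.pow i)

theorem fderiv_eval₂ (hU : IsOpen U) (hz : z ∈ U) (hs : AnalyticAt ℂ s z) (A B : ℂ × ℂ)
    (p : (holo U)[X]) :
    fderiv ℂ (fun y => p.eval₂ (evalAt U y) (s y)) z (A + s z • B) =
      (slopeDer (dirDer hU A) (dirDer hU B) p).eval₂ (evalAt U z) (s z) +
        (derivative p).eval₂ (evalAt U z) (s z) * fderiv ℂ s z (A + s z • B) := by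
  induction p using Polynomial.induction_on' with
  | add p q hp hq =>
    simp only [eval₂_add]
    rw [fderiv_fun_add (analyticAt_eval₂ hz hs p).differentiableAt
      (analyticAt_eval₂ hz hs q).differentiableAt, add_apply, hp, hq,
      map_add (slopeDer _ _) p q, derivative_add, eval₂_add, eval₂_add]
    ring
  | monomial n a =>
    have h1 : HasFDerivAt (fun y => (a : ℂ × ℂ → ℂ) y * s y ^ n)
        ((a : ℂ × ℂ → ℂ) z • ((n * s z ^ (n - 1)) • fderiv ℂ s z) +
          (s z ^ n) • fderiv ℂ (a : ℂ × ℂ → ℂ) z) z := by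
      refine (a.2 z hz).differentiableAt.hasFDerivAt.mul ?_
      simpa using hs.differentiableAt.hasFDerivAt.pow n
    simp only [eval₂_monomial, evalAt_apply]
    rw [h1.fderiv]
    simp only [slopeDer, Derivation.add_apply, Derivation.smul_apply, coeffDer_monomial,
      derivative_monomial, eval₂_add, eval₂_mul, eval₂_X, eval₂_monomial, evalAt_apply, smul_eq_mul,
      dirDer_apply hU _ _ hz, add_apply, smul_apply, map_add, map_smul, map_mul, map_natCast]
    ring

/-- Differentiating `P(s) = 0` along `w = A + s • B` gives `(slopeDer P)(s) = -P'(s) w(s)`, so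
`P'(s) w(p(s)) = (webDer p)(s)` for every `p`. The scale is 1 at `l = 0` because `g` does not
involve the slope. -/
theorem scaledIterLie_eq_webRow (hU : IsOpen U) (hz : z ∈ U) (hs : AnalyticAt ℂ s z)
    (A B : ℂ × ℂ) {P : (holo U)[X]} (hP : ∀ᶠ y in 𝓝 z, P.eval₂ (evalAt U y) (s y) = 0)
    (g : holo U) (i : ℕ) :
    scaledIterLie (fun y => A + s y • B)
      (fun l y => if l = 0 then 1 else (derivative P).eval₂ (evalAt U y) (s y)) i g =ᶠ[𝓝 z]
      fun y => (webRow (dirDer hU A) (dirDer hU B) P i g).eval₂ (evalAt U y) (s y) := by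
  cases i with
  | zero =>
    refine Filter.Eventually.of_forall fun y => ?_
    simp [scaledIterLie, webRow, evalAt_apply]
  | succ i =>
    induction i with
    | zero =>
      filter_upwards [hU.mem_nhds hz, hs.eventually_analyticAt] with y hy hsy
      have := fderiv_eval₂ hU hy hsy A B (C g)
      simp only [eval₂_C, evalAt_apply, derivative_C, eval₂_zero, zero_mul, add_zero] at this
      simpa [scaledIterLie, webRow] using this
    | succ i ih =>
      filter_upwards [hU.mem_nhds hz, hs.eventually_analyticAt, ih.eventuallyEq_nhds,
        hP.eventually_nhds] with y hy hsy hi hPy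
      have h1 := fderiv_eval₂ hU hy hsy A B (webRow (dirDer hU A) (dirDer hU B) P (i + 1) g)
      have h2 := fderiv_eval₂ hU hy hsy A B P
      have h3 : (fun y => P.eval₂ (evalAt U y) (s y)) =ᶠ[𝓝 y] fun _ => 0 := hPy
      rw [h3.fderiv_eq] at h2
      simp only [fderiv_fun_const, Pi.zero_apply, zero_apply] at h2
      have h4 : webRow (dirDer hU A) (dirDer hU B) P (i + 1 + 1) g =
          webDer (dirDer hU A) (dirDer hU B) P
            (webRow (dirDer hU A) (dirDer hU B) P (i + 1) g) := by
        simp only [webRow, Function.iterate_succ_apply']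
      rw [h4, webDer_apply]
      change (if i + 1 = 0 then 1 else (derivative P).eval₂ (evalAt U y) (s y)) *
        fderiv ℂ (scaledIterLie _ _ (i + 1) g) y (A + s y • B) = _
      rw [if_neg (Nat.succ_ne_zero i), hi.fderiv_eq, h1, eval₂_sub, eval₂_mul, eval₂_mul]
      linear_combination (-(derivative (webRow (dirDer hU A) (dirDer hU B) P (i + 1) g)).eval₂
        (evalAt U y) (s y)) * h2

theorem eval₂_webDet (hU : IsOpen U) (hz : z ∈ U) (hs : AnalyticAt ℂ s z)
    (A B : ℂ × ℂ) {P : (holo U)[X]} (hP : ∀ᶠ y in 𝓝 z, P.eval₂ (evalAt U y) (s y) = 0)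
    {k : ℕ} (g : Fin (k + 1) → holo U) :
    (webDet (dirDer hU A) (dirDer hU B) P g).eval₂ (evalAt U z) (s z) =
      (derivative P).eval₂ (evalAt U z) (s z) ^ (k * (k - 1) / 2) *
        action (fun j => (g j : ℂ × ℂ → ℂ)) (fun y => A + s y • B) z := by
  have hc : ∀ l : ℕ, AnalyticAt ℂ
      (fun y => if l = 0 then 1 else (derivative P).eval₂ (evalAt U y) (s y)) z := by
    intro l
    by_cases hl : l = 0
    · simpa [hl] using analyticAt_const
    · simpa [hl] using analyticAt_eval₂ hz hs (derivative P)
  have hw : AnalyticAt ℂ (fun y => A + s y • B) z :=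
    analyticAt_const.add (hs.smul analyticAt_const)
  have h := det_scaledIterLie (g := fun j => (g j : ℂ × ℂ → ℂ)) hw hc fun j => (g j).2 z hz
  rw [prod_range_prod_ite] at h
  rw [← h, webDet, ← coe_eval₂RingHom]
  refine (RingHom.map_det (R := (holo U)[X]) (S := ℂ) (eval₂RingHom (evalAt U z) (s z))
    (Matrix.of fun i j : Fin (k + 1) =>
      webRow (dirDer hU A) (dirDer hU B) P (i : ℕ) (g j))).trans ?_
  congr 1
  ext i j
  exact (scaledIterLie_eq_webRow hU hz hs A B hP (g j) i).self_of_nhds.symm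

end Slope

/-! ## The extactic function as a resultant -/

/-- As `P` is monic, the formula survives a drop of the degree of `D` under evaluation. -/
theorem evalAt_resultant {U : Set (ℂ × ℂ)} {P D : (holo U)[X]} (hP : P.Monic) (z : ℂ × ℂ) :
    evalAt U z (resultant P D) =
      ((P.map (evalAt U z)).roots.map fun x => D.eval₂ (evalAt U z) x).prod := by
  have h := resultant_eq_prod_eval (P.map (evalAt U z)) (D.map (evalAt U z)) D.natDegree
    natDegree_map_le (IsAlgClosed.splits _)
  rw [hP.natDegree_map, resultant_map_map, (hP.map _).leadingCoeff, one_pow, one_mul] at h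
  simpa only [eval_map] using h

theorem prod_compl_mul {d : ℕ} {ρ : Fin d → ℂ} (hρ : ∏ i, ρ i ≠ 0) :
    ∏ i, ∏ j ∈ ({i} : Finset (Fin d))ᶜ, ρ j * ρ i = (∏ i, ρ i) ^ (2 * (d - 1)) := by
  have h1 : ∏ i, ∏ j ∈ ({i} : Finset (Fin d))ᶜ, ρ i = (∏ i, ρ i) ^ (d - 1) := by
    simp [Finset.card_compl, Finset.prod_pow]
  have h2 : (∏ i, ∏ j ∈ ({i} : Finset (Fin d))ᶜ, ρ j) * ∏ i, ρ i = (∏ i, ρ i) ^ d := by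
    rw [← Finset.prod_mul_distrib]
    have : ∀ i ∈ (Finset.univ : Finset (Fin d)),
        (∏ j ∈ ({i} : Finset (Fin d))ᶜ, ρ j) * ρ i = ∏ i, ρ i := fun i _ => by
      rw [← Finset.prod_compl_mul_prod {i} ρ, Finset.prod_singleton]
    rw [Finset.prod_congr rfl this]
    simp
  have h3 : ∏ i, ∏ j ∈ ({i} : Finset (Fin d))ᶜ, ρ j = (∏ i, ρ i) ^ (d - 1) := by
    rcases Nat.eq_zero_or_pos d with rfl | hd
    · simp
    · refine mul_right_cancel₀ hρ ?_
      rw [h2, ← pow_succ, Nat.sub_add_cancel hd]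
  simp only [Finset.prod_mul_distrib, h1, h3]
  rw [two_mul, pow_add]

/-- The sign relating the discriminant of a product of linear forms to the product of the
derivatives at the roots. -/
def discSign (d : ℕ) : ℂ := ∏ i : Fin d, ∏ _j ∈ Finset.Ioi i, (-1)

/-- The determinant of `u i` and `u j` is `ρ i * ρ j * (s j - s i)`. The product of the derivatives
runs over ordered pairs, hence a sign for each unordered pair. -/
theorem discProd_eq {d : ℕ} (t : ℂ) {u : Fin d → ℂ × ℂ} {ρ s : Fin d → ℂ}
    (hu : ∀ i, u i = ρ i • (((1 : ℂ), (0 : ℂ)) + s i • (-t, (1 : ℂ)))) (hρ : ∏ i, ρ i ≠ 0) :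
    discProd u = discSign d * ((∏ i, ρ i) ^ (2 * (d - 1)) *
      ∏ i, (derivative (∏ j, (X - C (s j)))).eval (s i)) := by
  have hder : ∀ i, (derivative (∏ j, (X - C (s j)))).eval (s i) =
      ∏ j ∈ ({i} : Finset (Fin d))ᶜ, (s i - s j) := by
    intro i
    rw [derivative_prod_finset, eval_finsetSum, Finset.sum_eq_single i]
    · simp [eval_prod, Finset.compl_singleton]
    · intro b _ hb
      rw [eval_mul, eval_prod, Finset.prod_eq_zero (i := i)]
      · simp
      · simp [hb.symm]
      · simp
    · simp
  rw [← prod_compl_mul hρ]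
  simp only [hder]
  rw [← Finset.prod_mul_distrib]
  simp only [← Finset.prod_mul_distrib]
  rw [← Finset.prod_prod_Ioi_mul_eq_prod_prod_off_diag
    (fun j i : Fin d => ρ j * ρ i * (s i - s j)), discSign, discProd, ← Finset.prod_mul_distrib]
  refine Finset.prod_congr rfl fun i _ => ?_
  rw [← Finset.prod_mul_distrib]
  refine Finset.prod_congr rfl fun j _ => ?_
  simp only [hu, Prod.smul_fst, Prod.smul_snd, Prod.fst_add, Prod.snd_add, smul_eq_mul]
  ring

theorem eq_zero_of_forall_prod_eq_zero {d : ℕ} {u : Fin d → ℂ × ℂ}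
    (h : ∀ ξ : ℂ × ℂ, ∏ i, (ξ.1 * (u i).1 + ξ.2 * (u i).2) = 0) : ∃ i, u i = 0 := by
  by_contra! hne
  have hQ : ∏ i, (C (u i).1 + C (u i).2 * X : ℂ[X]) ≠ 0 := by
    rw [Finset.prod_ne_zero_iff]
    intro i _ h0
    have h1 := congrArg (fun p : ℂ[X] => p.coeff 0) h0
    have h2 := congrArg (fun p : ℂ[X] => p.coeff 1) h0
    simp at h1
    simp [coeff_C] at h2
    exact hne i (Prod.ext h1 h2)
  refine hQ (Polynomial.funext fun x => ?_)
  simp only [eval_prod, eval_add, eval_mul, eval_C, eval_X, eval_zero]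
  rw [← h (1, x)]
  exact Finset.prod_congr rfl fun i _ => by ring

/-- The data at a point where a web is monic with respect to the slope coordinate. -/
structure SlopePresentation (d : ℕ) (U : Set (ℂ × ℂ)) (F : ℂ × ℂ → ℂ × ℂ → ℂ) (t : ℂ)
    (a : holo U) (P : (holo U)[X]) : Prop where
  monic : P.Monic
  natDegree_eq : P.natDegree = d
  apply_slope : ∀ y ∈ U, ∀ x : ℂ,
    F y (x, t * x - 1) = (a : ℂ × ℂ → ℂ) y * P.eval₂ (evalAt U y) x
  apply_base : ∀ y ∈ U, F y (1, t) = (a : ℂ × ℂ → ℂ) y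
  eq_zero : ∀ y ∈ U, (a : ℂ × ℂ → ℂ) y = 0 → ∀ ξ, F y ξ = 0

/-- The exponent of the leading coefficient of the web in the extactic function. -/
def leadExponent (d k : ℕ) : ℕ := 2 * (d - 1) * (k * (k - 1) / 2) + (k + 1) * k / 2

/-- The extactic function. -/
noncomputable def extacticFn {U : Set (ℂ × ℂ)} (hU : IsOpen U) (d : ℕ) {k : ℕ} (t : ℂ)
    (a : holo U) (P : (holo U)[X]) (g : Fin (k + 1) → holo U) (z : ℂ × ℂ) : ℂ :=
  discSign d ^ (k * (k - 1) / 2) * ((a : ℂ × ℂ → ℂ) z ^ leadExponent d k *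
    evalAt U z (resultant P (webDet (dirDer hU (1, 0)) (dirDer hU (-t, 1)) P g)))

theorem analyticAt_extacticFn {U : Set (ℂ × ℂ)} (hU : IsOpen U) (d : ℕ) {k : ℕ} (t : ℂ)
    (a : holo U) (P : (holo U)[X]) (g : Fin (k + 1) → holo U) {z : ℂ × ℂ} (hz : z ∈ U) :
    AnalyticAt ℂ (extacticFn hU d t a P g) z :=
  analyticAt_const.mul (((a.2 z hz).pow _).mul (Subtype.property (resultant P _) z hz))

/-- Writing `u i = ρ i • (A + s i • B)`, where the product of the `ρ i` is `a`, the discriminant has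
weight `2 * (d - 1)` in `a` and each Wronskian has weight `(k + 1) * k / 2` in `ρ i`. These weights
add up to `leadExponent`. -/
theorem extacticFn_eq {U : Set (ℂ × ℂ)} (hU : IsOpen U) {d k : ℕ} (hk : 1 ≤ k) {t : ℂ}
    {F : ℂ × ℂ → ℂ × ℂ → ℂ} {a : holo U} {P : (holo U)[X]} (g : Fin (k + 1) → holo U)
    (hP : SlopePresentation d U F t a P) {z : ℂ × ℂ} (hz : z ∈ U)
    {u : Fin d → ℂ × ℂ → ℂ × ℂ} (hu : IsDecomposition F u z) :
    extacticFn hU d t a P g z = discProd (fun i => u i z) ^ (k * (k - 1) / 2) *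
      ∏ i, action (fun j => (g j : ℂ × ℂ → ℂ)) (u i) z := by
  obtain ⟨hua, hF⟩ := hu
  have hlead : leadExponent d k ≠ 0 := by
    have : 1 ≤ (k + 1) * k / 2 := by
      rw [Nat.le_div_iff_mul_le two_pos]
      nlinarith
    unfold leadExponent
    omega
  -- Where `a` vanishes so does the form, hence one factor `u i`; both sides are then zero, as
  -- `leadExponent` is positive.
  by_cases ha : (a : ℂ × ℂ → ℂ) z = 0
  · obtain ⟨i, hi⟩ := eq_zero_of_forall_prod_eq_zero (u := fun i => u i z) fun ξ => by
      rw [← hF.self_of_nhds ξ, hP.eq_zero z hz ha]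
    rw [extacticFn, ha, zero_pow hlead, Finset.prod_eq_zero (Finset.mem_univ i)
      (action_eq_zero hk hi _)]
    simp
  -- The pairing of `u i` with the covector `(1, t)`; the covector `(x, t * x - 1)` kills `A + x •
  -- B`, so it detects the slope.
  let ρ : Fin d → ℂ × ℂ → ℂ := fun i y => (u i y).1 + t * (u i y).2
  let s : Fin d → ℂ × ℂ → ℂ := fun i y => (u i y).2 / ρ i y
  have hu1 : ∀ i, AnalyticAt ℂ (fun y => (u i y).1) z := fun i =>
    (ContinuousLinearMap.fst ℂ ℂ ℂ).analyticAt _ |>.comp (hua i)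
  have hu2 : ∀ i, AnalyticAt ℂ (fun y => (u i y).2) z := fun i =>
    (ContinuousLinearMap.snd ℂ ℂ ℂ).analyticAt _ |>.comp (hua i)
  have hρa : ∀ i, AnalyticAt ℂ (ρ i) z := fun i =>
    (hu1 i).add (analyticAt_const.mul (hu2 i))
  have haρ : ∀ᶠ y in 𝓝 z, (a : ℂ × ℂ → ℂ) y = ∏ i, ρ i y := by
    filter_upwards [hF, hU.mem_nhds hz] with y hy hyU
    rw [← hP.apply_base y hyU, hy]
    simp [ρ]
  have hρ0 : ∀ i, ρ i z ≠ 0 := by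
    have := haρ.self_of_nhds
    rw [this, ← ne_eq, Finset.prod_ne_zero_iff] at ha
    exact fun i => ha i (Finset.mem_univ i)
  have hsa : ∀ i, AnalyticAt ℂ (s i) z := fun i => (hu2 i).div (hρa i) (hρ0 i)
  have hus : ∀ᶠ y in 𝓝 z, ∀ i, ρ i y ≠ 0 ∧
      u i y = ρ i y • (((1 : ℂ), (0 : ℂ)) + s i y • (-t, (1 : ℂ))) := by
    rw [Filter.eventually_all]
    intro i
    filter_upwards [(hρa i).continuousAt.eventually_ne (hρ0 i)] with y hy
    refine ⟨hy, Prod.ext ?_ ?_⟩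
    · have h1 : ρ i y * s i y = (u i y).2 := mul_div_cancel₀ _ hy
      simp only [Prod.smul_fst, Prod.fst_add, smul_eq_mul]
      have h2 : ρ i y = (u i y).1 + t * (u i y).2 := rfl
      linear_combination t * h1 - h2
    · have h1 : ρ i y * s i y = (u i y).2 := mul_div_cancel₀ _ hy
      simp only [Prod.smul_snd, Prod.snd_add, smul_eq_mul]
      linear_combination -h1
  have hfac : ∀ᶠ y in 𝓝 z, P.map (evalAt U y) = ∏ i, (X - C (s i y)) := by
    filter_upwards [hF, hU.mem_nhds hz, haρ, hus] with y hy hyU hya hyu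
    refine Polynomial.funext fun x => ?_
    have h1 := hP.apply_slope y hyU x
    have ha0 : ∏ i, ρ i y ≠ 0 := Finset.prod_ne_zero_iff.2 fun i _ => (hyu i).1
    rw [hy, hya] at h1
    rw [eval_map]
    refine mul_left_cancel₀ ha0 ?_
    rw [← h1, eval_prod, ← Finset.prod_mul_distrib]
    refine Finset.prod_congr rfl fun i _ => ?_
    have h2 : ρ i y * s i y = (u i y).2 := mul_div_cancel₀ _ (hyu i).1
    have h3 : ρ i y = (u i y).1 + t * (u i y).2 := rfl
    simp only [eval_sub, eval_X, eval_C]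
    linear_combination h2 - x * h3
  have hroot : ∀ i, ∀ᶠ y in 𝓝 z, P.eval₂ (evalAt U y) (s i y) = 0 := by
    intro i
    filter_upwards [hfac] with y hy
    rw [← eval_map, hy, eval_prod, Finset.prod_eq_zero (Finset.mem_univ i)]
    simp
  have hD : ∀ i, (webDet (dirDer hU (1, 0)) (dirDer hU (-t, 1)) P g).eval₂ (evalAt U z) (s i z) =
      (derivative (∏ j, (X - C (s j z)))).eval (s i z) ^ (k * (k - 1) / 2) *
        action (fun j => (g j : ℂ × ℂ → ℂ)) (fun y => (1, 0) + s i y • (-t, 1)) z := by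
    intro i
    rw [eval₂_webDet hU hz (hsa i) _ _ (hroot i), ← hfac.self_of_nhds, derivative_map, eval_map]
  have hact : ∀ i, action (fun j => (g j : ℂ × ℂ → ℂ)) (u i) z = ρ i z ^ ((k + 1) * k / 2) *
      action (fun j => (g j : ℂ × ℂ → ℂ)) (fun y => (1, 0) + s i y • (-t, 1)) z := by
    intro i
    rw [action_congr (hus.mono fun y hy => (hy i).2)]
    exact action_smul (analyticAt_const.add ((hsa i).smul analyticAt_const)) (hρa i)
      fun j => (g j).2 z hz
  have hroots : (P.map (evalAt U z)).roots = Finset.univ.val.map fun i => s i z := by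
    rw [hfac.self_of_nhds, ← roots_multiset_prod_X_sub_C (Finset.univ.val.map fun i => s i z),
      Multiset.map_map]
    rfl
  rw [extacticFn, evalAt_resultant hP.monic, hroots, Multiset.map_map, discProd_eq t
    (ρ := fun i => ρ i z) (s := fun i => s i z) (fun i => (hus.self_of_nhds i).2)
    (haρ.self_of_nhds ▸ ha), ← haρ.self_of_nhds]
  have hres : (Finset.univ.val.map ((fun x => (webDet (dirDer hU (1, 0)) (dirDer hU (-t, 1))
      P g).eval₂ (evalAt U z) x) ∘ fun i => s i z)).prod =
      (∏ i, (derivative (∏ j, (X - C (s j z)))).eval (s i z)) ^ (k * (k - 1) / 2) *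
        ∏ i, action (fun j => (g j : ℂ × ℂ → ℂ)) (fun y => (1, 0) + s i y • (-t, 1)) z := by
    rw [← Finset.prod_pow, ← Finset.prod_mul_distrib]
    exact Finset.prod_congr rfl fun i _ => hD i
  rw [hres]
  simp only [hact]
  rw [Finset.prod_mul_distrib, Finset.prod_pow, ← haρ.self_of_nhds, leadExponent]
  ring

theorem isExtacticFunction_extacticFn {U : Set (ℂ × ℂ)} (hU : IsOpen U) {d k : ℕ} (hk : 1 ≤ k)
    {t : ℂ} {F : ℂ × ℂ → ℂ × ℂ → ℂ} {a : holo U} {P : (holo U)[X]} (g : Fin (k + 1) → holo U)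
    (hP : SlopePresentation d U F t a P) {z : ℂ × ℂ} (hz : z ∈ U) :
    IsExtacticFunction d F (fun j => (g j : ℂ × ℂ → ℂ)) (extacticFn hU d t a P g) z := by
  refine ⟨analyticAt_extacticFn hU d t a P g hz, ?_⟩
  filter_upwards [hU.mem_nhds hz] with y hy u hu _
  exact extacticFn_eq hU hk g hP hy hu

/-- The vanishing comes from a Wronskian factor, which also covers `d = 1`, where the discriminant
is the empty product. -/
theorem isExtacticFunction_zero {d k : ℕ} (hk : 1 ≤ k) {F : ℂ × ℂ → ℂ × ℂ → ℂ}
    {g : Fin (k + 1) → ℂ × ℂ → ℂ} {z : ℂ × ℂ} (hF : ∀ᶠ y in 𝓝 z, ∀ ξ, F y ξ = 0) :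
    IsExtacticFunction d F g (fun _ => 0) z := by
  refine ⟨analyticAt_const, ?_⟩
  filter_upwards [hF] with y hy u hu _
  obtain ⟨i, hi⟩ := eq_zero_of_forall_prod_eq_zero (u := fun i => u i y) fun ξ => by
    rw [← hu.2.self_of_nhds ξ, hy]
  rw [Finset.prod_eq_zero (Finset.mem_univ i) (action_eq_zero hk hi _), mul_zero]

/-! ## Estimates for resultants -/

/-- Either one truncated factor equals `φ` and the others are at most `L`, or no factor is truncated
and the hypothesis on the product applies. -/
theorem prod_max_le (s : Multiset ℂ) (w : ℂ → ℝ) {φ L R : ℝ} (hφ : 0 ≤ φ) 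
    (hL : 1 ≤ L) (hφL : φ ≤ L) (hwL : ∀ x ∈ s, w x ≤ L) (hR : 0 ≤ R)
    (h : (s.map w).prod ≤ R * φ) :
    (s.map fun x => max φ (w x)).prod ≤ (R + L ^ s.card) * φ := by
  by_cases hx : ∃ x ∈ s, w x < φ
  · obtain ⟨x, hx, hxφ⟩ := hx
    obtain ⟨s', rfl⟩ := Multiset.exists_cons_of_mem hx
    rw [Multiset.map_cons, Multiset.prod_cons, max_eq_left hxφ.le, mul_comm]
    refine mul_le_mul_of_nonneg_right ?_ hφ
    have h1 : (s'.map fun x => max φ (w x)).prod ≤ (s'.map fun _ => L).prod :=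
      Multiset.prod_map_le_prod_map₀ _ _ (fun y _ => le_max_of_le_left hφ)
        fun y hy => max_le hφL (hwL y (Multiset.mem_cons_of_mem hy))
    rw [Multiset.map_const', Multiset.prod_replicate] at h1
    have h2 : L ^ s'.card ≤ L ^ (x ::ₘ s').card := pow_le_pow_right₀ hL (by simp)
    linarith
  · push Not at hx
    have h1 : (s.map fun x => max φ (w x)) = s.map w :=
      Multiset.map_congr rfl fun x hxs => max_eq_right (hx x hxs)
    rw [h1]
    refine h.trans (mul_le_mul_of_nonneg_right ?_ hφ)
    have : 0 ≤ L ^ s.card := by positivity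
    linarith

section Bounds

variable {U : Set (ℂ × ℂ)} {z₀ : ℂ × ℂ}

theorem eventually_norm_le (hz₀ : z₀ ∈ U) (a : holo U) :
    ∀ᶠ z in 𝓝 z₀, ‖evalAt U z a‖ ≤ ‖evalAt U z₀ a‖ + 1 := by
  have h : ContinuousAt (fun z => ‖evalAt U z a‖) z₀ := (a.2 z₀ hz₀).continuousAt.norm
  exact (h.eventually_lt_const (lt_add_one _)).mono fun z hz => hz.le

theorem exists_bound_eval₂ (hz₀ : z₀ ∈ U) (p : (holo U)[X]) {K : ℝ} :
    ∃ M : ℝ, 0 ≤ M ∧ ∀ᶠ z in 𝓝 z₀, ∀ x : ℂ, ‖x‖ ≤ K → ‖p.eval₂ (evalAt U z) x‖ ≤ M := by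
  by_cases hK : 0 ≤ K
  · refine ⟨∑ i ∈ Finset.range (p.natDegree + 1), (‖evalAt U z₀ (p.coeff i)‖ + 1) * K ^ i,
      Finset.sum_nonneg fun i _ => by positivity, ?_⟩
    have h : ∀ᶠ z in 𝓝 z₀, ∀ i ∈ Finset.range (p.natDegree + 1),
        ‖evalAt U z (p.coeff i)‖ ≤ ‖evalAt U z₀ (p.coeff i)‖ + 1 := by
      rw [Filter.eventually_all_finset]
      exact fun i _ => eventually_norm_le hz₀ _
    filter_upwards [h] with z hz x hx
    rw [eval₂_eq_sum_range]
    refine (norm_sum_le _ _).trans (Finset.sum_le_sum fun i hi => ?_)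
    rw [norm_mul, norm_pow]
    gcongr
    exact hz i hi
  · exact ⟨0, le_rfl, Filter.Eventually.of_forall fun z x hx =>
      absurd ((norm_nonneg x).trans hx) hK⟩

theorem exists_bound_roots (hz₀ : z₀ ∈ U) {P : (holo U)[X]} (hP : P.Monic) :
    ∃ K : ℝ, ∀ᶠ z in 𝓝 z₀, ∀ x ∈ (P.map (evalAt U z)).roots, ‖x‖ ≤ K := by
  refine ⟨(∑ i ∈ Finset.range P.natDegree, (‖evalAt U z₀ (P.coeff i)‖ + 1)) + 1, ?_⟩
  have h : ∀ᶠ z in 𝓝 z₀, ∀ i ∈ Finset.range P.natDegree,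
      ‖evalAt U z (P.coeff i)‖ ≤ ‖evalAt U z₀ (P.coeff i)‖ + 1 := by
    rw [Filter.eventually_all_finset]
    exact fun i _ => eventually_norm_le hz₀ _
  filter_upwards [h] with z hz x hx
  have hm := hP.map (evalAt U z)
  have h1 := IsRoot.norm_lt_cauchyBound hm.ne_zero (isRoot_of_mem_roots hx)
  rw [cauchyBound, hm.leadingCoeff, nnnorm_one, div_one, hP.natDegree_map] at h1
  have h2 : (((Finset.range P.natDegree).sup fun i => ‖(P.map (evalAt U z)).coeff i‖₊ : NNReal) : ℝ)
      ≤ ∑ i ∈ Finset.range P.natDegree, (‖evalAt U z₀ (P.coeff i)‖ + 1) := by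
    have hnn : 0 ≤ ∑ i ∈ Finset.range P.natDegree, (‖evalAt U z₀ (P.coeff i)‖ + 1) :=
      Finset.sum_nonneg fun i _ => by positivity
    rw [← NNReal.coe_mk _ hnn, NNReal.coe_le_coe]
    refine Finset.sup_le fun i hi => ?_
    rw [← NNReal.coe_le_coe, coe_nnnorm, coeff_map, NNReal.coe_mk]
    refine (hz i hi).trans ?_
    exact Finset.single_le_sum (f := fun i => ‖evalAt U z₀ (P.coeff i)‖ + 1)
      (fun j _ => by positivity) hi
  have h3 : ‖x‖ < ((Finset.range P.natDegree).sup fun i => ‖(P.map (evalAt U z)).coeff i‖₊ : NNReal)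
      + 1 := by exact_mod_cast h1
  linarith

/-- Both generators are bounded by the maximum, and the cofactors are bounded for `‖x‖ ≤ K` and `z`
near `z₀`. -/
theorem exists_bound_of_mem_pow (hz₀ : z₀ ∈ U) (f c : holo U) (K : ℝ) (n : ℕ)
    {D : (holo U)[X]} (hD : D ∈ Ideal.span {C f, X - C c} ^ n) :
    ∃ M : ℝ, 0 ≤ M ∧ ∀ᶠ z in 𝓝 z₀, ∀ x : ℂ, ‖x‖ ≤ K → ‖D.eval₂ (evalAt U z) x‖ ≤
      M * max ‖evalAt U z f‖ ‖x - evalAt U z c‖ ^ n := by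
  induction n generalizing D with
  | zero =>
    obtain ⟨M, hM, h⟩ := exists_bound_eval₂ hz₀ D (K := K)
    exact ⟨M, hM, by simpa using h⟩
  | succ n ih =>
    replace hD : D ∈ Ideal.span {C f, X - C c} ^ n * Ideal.span {C f, X - C c} :=
      (pow_succ (Ideal.span {C f, X - C c}) n).le hD
    induction hD using Submodule.mul_induction_on' with
    | mem_mul_mem p hp q hq =>
      obtain ⟨M, hM, h⟩ := ih hp
      obtain ⟨a, b, rfl⟩ := Ideal.mem_span_pair.1 hq
      obtain ⟨Ma, hMa, ha⟩ := exists_bound_eval₂ hz₀ a (K := K)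
      obtain ⟨Mb, hMb, hb⟩ := exists_bound_eval₂ hz₀ b (K := K)
      refine ⟨M * (Ma + Mb), by positivity, ?_⟩
      filter_upwards [h, ha, hb] with z hz hza hzb x hx
      set μ := max ‖evalAt U z f‖ ‖x - evalAt U z c‖ with hμ
      have hμ0 : 0 ≤ μ := le_max_of_le_left (norm_nonneg _)
      have h1 : ‖(a * C f + b * (X - C c)).eval₂ (evalAt U z) x‖ ≤ (Ma + Mb) * μ := by
        rw [eval₂_add, eval₂_mul, eval₂_mul, eval₂_sub, eval₂_C, eval₂_C, eval₂_X, add_mul]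
        refine (norm_add_le _ _).trans (add_le_add ?_ ?_)
        · rw [norm_mul]
          exact mul_le_mul (hza x hx) (le_max_left _ _) (norm_nonneg _) hMa
        · rw [norm_mul]
          exact mul_le_mul (hzb x hx) (le_max_right _ _) (norm_nonneg _) hMb
      rw [eval₂_mul, norm_mul]
      calc _ ≤ (M * μ ^ n) * ((Ma + Mb) * μ) :=
            mul_le_mul (hz x hx) h1 (norm_nonneg _) (by positivity)
        _ = _ := by ring
    | add p _ q _ hp hq =>
      obtain ⟨Mp, hMp, hp⟩ := hp
      obtain ⟨Mq, hMq, hq⟩ := hq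
      refine ⟨Mp + Mq, by positivity, ?_⟩
      filter_upwards [hp, hq] with z hzp hzq x hx
      rw [eval₂_add, add_mul]
      exact (norm_add_le _ _).trans (add_le_add (hzp x hx) (hzq x hx))

/-- The resultant is the product of `D(x)` over the roots `x` of `P`, each `O(max(|f|, |x - c|) ^
n)`. Since the product of `|x - c|` is `|P(c)| = |f r|`, `prod_max_le` bounds the product of the
maxima by a constant times `|f|`. -/
theorem exists_bound_resultant (hz₀ : z₀ ∈ U) {f c r : holo U} {P : (holo U)[X]} (hP : P.Monic)
    (hPc : P.eval c = f * r) {n : ℕ} {D : (holo U)[X]}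
    (hD : D ∈ Ideal.span {C f, X - C c} ^ n) :
    ∃ M : ℝ, ∀ᶠ z in 𝓝 z₀, ‖evalAt U z (resultant P D)‖ ≤ M * ‖evalAt U z f‖ ^ n := by
  obtain ⟨K, hK⟩ := exists_bound_roots hz₀ hP
  obtain ⟨M, hM, hMD⟩ := exists_bound_of_mem_pow hz₀ f c K n hD
  set R := ‖evalAt U z₀ r‖ + 1 with hR
  set Lf := ‖evalAt U z₀ f‖ + 1 with hLf
  set Lc := ‖evalAt U z₀ c‖ + 1 with hLc
  set L := Lf + (|K| + Lc) with hL
  have hR0 : 0 ≤ R := by positivity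
  have hLf0 : 1 ≤ Lf := by simp [hLf]
  have hLc0 : 0 ≤ Lc := by positivity
  have hL1 : 1 ≤ L := by
    have := abs_nonneg K
    linarith
  refine ⟨M ^ P.natDegree * (R + L ^ P.natDegree) ^ n, ?_⟩
  filter_upwards [hK, hMD, eventually_norm_le hz₀ r, eventually_norm_le hz₀ f,
    eventually_norm_le hz₀ c] with z hzK hzM hzr hzf hzc
  set s := (P.map (evalAt U z)).roots with hs
  have hsplit : (P.map (evalAt U z)).Splits := IsAlgClosed.splits _
  have hcard : s.card = P.natDegree := by
    rw [hs, ← hsplit.natDegree_eq_card_roots, hP.natDegree_map]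
  have hprod : (s.map fun x => ‖x - evalAt U z c‖).prod ≤ R * ‖evalAt U z f‖ := by
    have h1 : (P.map (evalAt U z)).eval (evalAt U z c) =
        (s.map fun x => evalAt U z c - x).prod := by
      rw [hsplit.eval_eq_prod_roots_of_monic (hP.map _)]
    have h2 : (P.map (evalAt U z)).eval (evalAt U z c) = evalAt U z f * evalAt U z r := by
      rw [eval_map, eval₂_at_apply, hPc, map_mul]
    have h3 : (s.map fun x => ‖x - evalAt U z c‖).prod = ‖evalAt U z f * evalAt U z r‖ := by
      rw [← h2, h1, ← normHom_apply, map_multiset_prod, Multiset.map_map]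
      congr 1
      exact Multiset.map_congr rfl fun x _ => norm_sub_rev _ _
    rw [h3, norm_mul, mul_comm]
    exact mul_le_mul_of_nonneg_right hzr (norm_nonneg _)
  have hmax := prod_max_le s (fun x => ‖x - evalAt U z c‖) (norm_nonneg (evalAt U z f))
    hL1 (by have := abs_nonneg K; linarith) (fun x hx => by
      have h1 := norm_sub_le x (evalAt U z c)
      have h2 := (hzK x hx).trans (le_abs_self K)
      linarith) hR0 hprod
  rw [hcard] at hmax
  rw [evalAt_resultant hP, ← normHom_apply, map_multiset_prod, Multiset.map_map]
  calc _ ≤ (s.map fun x => M * max ‖evalAt U z f‖ ‖x - evalAt U z c‖ ^ n).prod :=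
        Multiset.prod_map_le_prod_map₀ _ _ (fun x _ => norm_nonneg _) fun x hx =>
          hzM x (hzK x hx)
    _ = M ^ P.natDegree *
        (s.map fun x => max ‖evalAt U z f‖ ‖x - evalAt U z c‖).prod ^ n := by
      rw [Multiset.prod_map_mul, Multiset.map_const', Multiset.prod_replicate, hcard,
        Multiset.prod_map_pow]
    _ ≤ M ^ P.natDegree * ((R + L ^ P.natDegree) * ‖evalAt U z f‖) ^ n := by
      gcongr
      exact Multiset.prod_nonneg fun y hy => by
        obtain ⟨x, -, rfl⟩ := Multiset.mem_map.1 hy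
        exact le_max_of_le_left (norm_nonneg _)
    _ = _ := by rw [mul_pow]; ring

end Bounds

/-! ## The extactic function near a general point of a curve -/

/-- The binary form of degree `d` with coefficients `b`. -/
def binForm {d : ℕ} (b : Fin (d + 1) → ℂ) (ξ : ℂ × ℂ) : ℂ :=
  ∑ i, b i * (ξ.1 ^ (i : ℕ) * ξ.2 ^ (d - i))

theorem binForm_smul {d : ℕ} (b : Fin (d + 1) → ℂ) (s : ℂ) (ξ : ℂ × ℂ) :
    binForm b (s • ξ) = s ^ d * binForm b ξ := by
  rw [binForm, binForm, Finset.mul_sum]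
  refine Finset.sum_congr rfl fun i _ => ?_
  have : s ^ d = s ^ (i : ℕ) * s ^ (d - i) := by
    rw [← pow_add, Nat.add_sub_cancel' (Nat.lt_succ_iff.1 i.2)]
  rw [this, Prod.smul_fst, Prod.smul_snd, smul_eq_mul, smul_eq_mul, mul_pow, mul_pow]
  ring

theorem exists_binForm_ne_zero {d : ℕ} {b : Fin (d + 1) → ℂ} (h : ∃ i, b i ≠ 0) :
    ∃ t, binForm b (1, t) ≠ 0 := by
  obtain ⟨i, hi⟩ := h
  by_contra! hz
  have hp : (∑ j : Fin (d + 1), C (b j) * X ^ (d - (j : ℕ)) : ℂ[X]) = 0 := by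
    refine Polynomial.funext fun x => ?_
    have := hz x
    simpa [binForm, eval_finsetSum] using this
  have h1 := congrArg (fun p : ℂ[X] => p.coeff (d - (i : ℕ))) hp
  simp only [finsetSum_coeff, coeff_C_mul, coeff_X_pow, coeff_zero] at h1
  rw [Finset.sum_eq_single i] at h1
  · simp at h1
    exact hi h1
  · intro j _ hj
    have : d - (i : ℕ) ≠ d - (j : ℕ) := by
      intro h2
      apply hj
      ext
      omega
    simp [this]
  · simp

open Classical in
/-- The function equal to `f` on `U` and to `1` outside `U`. -/
noncomputable def extendOne (U : Set (ℂ × ℂ)) (hU : IsOpen U) {f : ℂ × ℂ → ℂ}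
    (hf : AnalyticOnNhd ℂ f U) : holo U :=
  ⟨fun z => if z ∈ U then f z else 1, fun z hz => (hf z hz).congr (by
    filter_upwards [hU.mem_nhds hz] with y hy
    simp [hy])⟩

theorem extendOne_apply {U : Set (ℂ × ℂ)} (hU : IsOpen U) {f : ℂ × ℂ → ℂ}
    (hf : AnalyticOnNhd ℂ f U) {z : ℂ × ℂ} (hz : z ∈ U) :
    (extendOne U hU hf : ℂ × ℂ → ℂ) z = f z := by
  classical
  exact if_pos hz

/-- Divisibility in `holo U` also concerns the arbitrary values off `U`; there the divisor is 1. -/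
theorem extendOne_dvd {U : Set (ℂ × ℂ)} (hU : IsOpen U) {f h : ℂ × ℂ → ℂ}
    (hf : AnalyticOnNhd ℂ f U) (hh : AnalyticOnNhd ℂ h U) {x : holo U}
    (hx : ∀ z ∈ U, (x : ℂ × ℂ → ℂ) z = f z * h z) : extendOne U hU hf ∣ x := by
  classical
  refine ⟨⟨fun z => if z ∈ U then h z else (x : ℂ × ℂ → ℂ) z, fun z hz => (hh z hz).congr ?_⟩, ?_⟩
  · filter_upwards [hU.mem_nhds hz] with y hy
    simp [hy]
  · ext z
    change _ = (if z ∈ U then f z else 1) * if z ∈ U then h z else (x : ℂ × ℂ → ℂ) z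
    by_cases hz : z ∈ U
    · rw [if_pos hz, if_pos hz, hx z hz]
    · rw [if_neg hz, if_neg hz, one_mul]

theorem natDegree_C_mul_X_sub_one_le {R : Type*} [CommRing R] (T : R) :
    (C T * X - 1 : R[X]).natDegree ≤ 1 := by
  rw [← C_1, sub_eq_add_neg, ← C_neg]
  exact natDegree_linear_le

theorem coeff_C_mul_X_sub_one_pow {R : Type*} [CommRing R] (T : R) (e : ℕ) :
    ((C T * X - 1 : R[X]) ^ e).coeff e = T ^ e := by
  have := coeff_pow_of_natDegree_le (m := e) (natDegree_C_mul_X_sub_one_le T)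
  rw [mul_one] at this
  rw [this, coeff_sub, coeff_C_mul, coeff_X_one, mul_one, coeff_one]
  simp

theorem exists_slopePresentation {d m : ℕ} {U : Set (ℂ × ℂ)} {F : ℂ × ℂ → ℂ × ℂ → ℂ}
    {f : ℂ × ℂ → ℂ} {b : Fin (d + 1) → ℂ × ℂ → ℂ} {t : ℂ} (hf : AnalyticOnNhd ℂ f U)
    (hb : ∀ i, AnalyticOnNhd ℂ (b i) U)
    (hF : ∀ y ∈ U, ∀ ξ, F y ξ = f y ^ m * binForm (fun i => b i y) ξ)
    (ht : ∀ y ∈ U, binForm (fun i => b i y) (1, t) ≠ 0) :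
    ∃ (a : holo U) (P : (holo U)[X]), SlopePresentation d U F t a P ∧
      (∀ y, (a : ℂ × ℂ → ℂ) y = f y ^ m * binForm (fun i => b i y) (1, t)) ∧
      ∀ y ∈ U, ∀ x, P.eval₂ (evalAt U y) x =
        binForm (fun i => b i y) (x, t * x - 1) / binForm (fun i => b i y) (1, t) := by
  have hlead : AnalyticOnNhd ℂ (fun y => binForm (fun i => b i y) (1, t)) U := fun y hy =>
    Finset.analyticAt_fun_sum _ fun i _ => (hb i y hy).mul analyticAt_const
  let a : holo U := ⟨fun y => f y ^ m * binForm (fun i => b i y) (1, t),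
    fun y hy => ((hf y hy).pow m).mul (hlead y hy)⟩
  let cf : Fin (d + 1) → holo U := fun i =>
    ⟨fun y => b i y / binForm (fun i => b i y) (1, t), fun y hy =>
      (hb i y hy).div (hlead y hy) (ht y hy)⟩
  let T : holo U := algebraMap ℂ (holo U) t
  let q : (holo U)[X] := ∑ i : Fin (d + 1), C (cf i) * (X ^ (i : ℕ) * (C T * X - 1) ^ (d - (i : ℕ)))
  -- The coefficient of `X ^ d` in `q` is 1 only on `U`; the correction, zero on `U`, makes `P`
  -- monic in `holo U`.
  let P : (holo U)[X] := q + C (1 - q.coeff d) * X ^ d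
  have hlin : (C T * X - 1 : (holo U)[X]).natDegree ≤ 1 := natDegree_C_mul_X_sub_one_le T
  have hqd : q.natDegree ≤ d := by
    refine natDegree_sum_le_of_forall_le _ _ fun i _ => ?_
    refine (natDegree_C_mul_le _ _).trans (natDegree_mul_le.trans ?_)
    have h1 := natDegree_X_pow_le (R := holo U) (i : ℕ)
    have h2 := natDegree_pow_le_of_le (d - (i : ℕ)) hlin
    have := i.2
    omega
  have hPd : P.natDegree ≤ d := by
    refine (natDegree_add_le _ _).trans (max_le hqd ?_)
    exact natDegree_C_mul_X_pow_le _ _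
  have hPc : P.coeff d = 1 := by
    simp only [P, coeff_add, coeff_C_mul_X_pow, if_true]
    ring
  have hmonic : P.Monic := monic_of_natDegree_le_of_coeff_eq_one d hPd hPc
  have hqc : ∀ y ∈ U, evalAt U y (q.coeff d) = 1 := by
    intro y hy
    have h1 : ∀ i : Fin (d + 1), (X ^ (i : ℕ) * (C T * X - 1) ^ (d - (i : ℕ)) :
        (holo U)[X]).coeff d = T ^ (d - (i : ℕ)) := by
      intro i
      have hi := Nat.lt_succ_iff.1 i.2
      rw [coeff_X_pow_mul', if_pos hi]
      exact coeff_C_mul_X_sub_one_pow T _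
    have h2 : ∀ e : ℕ, evalAt U y (T ^ e) = t ^ e := fun e => by
      rw [map_pow]; rfl
    simp only [q, finsetSum_coeff, coeff_C_mul, h1, map_sum, map_mul, h2]
    have h3 : ∀ i, evalAt U y (cf i) = b i y / binForm (fun i => b i y) (1, t) := fun i => rfl
    simp only [h3]
    have h4 : ∀ i : Fin (d + 1), b i y / binForm (fun i => b i y) (1, t) * t ^ (d - (i : ℕ)) =
        b i y * ((1 : ℂ) ^ (i : ℕ) * t ^ (d - (i : ℕ))) / binForm (fun i => b i y) (1, t) := by
      intro i
      rw [one_pow, one_mul]; ring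
    simp only [h4, ← Finset.sum_div]
    exact div_self (ht y hy)
  have heval : ∀ y ∈ U, ∀ x, P.eval₂ (evalAt U y) x =
        binForm (fun i => b i y) (x, t * x - 1) / binForm (fun i => b i y) (1, t) := by
    intro y hy x
    have h2 : evalAt U y T = t := rfl
    have h3 : ∀ i, evalAt U y (cf i) = b i y / binForm (fun i => b i y) (1, t) := fun i => rfl
    have h5 : P.eval₂ (evalAt U y) x = q.eval₂ (evalAt U y) x := by
      have h6 : evalAt U y (1 - q.coeff d) = 0 := by rw [map_sub, map_one, hqc y hy, sub_self]
      rw [eval₂_add, eval₂_mul, eval₂_C, h6, zero_mul, add_zero]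
    rw [h5]
    simp only [q, eval₂_finsetSum, eval₂_mul, eval₂_C, eval₂_pow, eval₂_X, eval₂_sub, eval₂_one,
      h2, h3]
    rw [show binForm (fun i => b i y) (x, t * x - 1) =
      ∑ i, b i y * (x ^ (i : ℕ) * (t * x - 1) ^ (d - i)) from rfl, Finset.sum_div]
    exact Finset.sum_congr rfl fun i _ => by ring
  refine ⟨a, P, ⟨hmonic, ?_, ?_, ?_, ?_⟩, fun y => rfl, heval⟩
  · refine le_antisymm hPd ?_
    by_contra hlt
    have h0 := coeff_eq_zero_of_natDegree_lt (not_le.1 hlt)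
    rw [hPc] at h0
    have : Nontrivial (holo U) := inferInstance
    exact one_ne_zero h0
  · intro y hy x
    rw [heval y hy, hF y hy]
    change _ = f y ^ m * binForm (fun i => b i y) (1, t) * _
    rw [mul_assoc, mul_div_cancel₀ _ (ht y hy)]
  · intro y hy
    exact hF y hy _
  · intro y hy ha ξ
    have : f y ^ m = 0 := by
      refine (mul_eq_zero.1 (?_ : f y ^ m * binForm (fun i => b i y) (1, t) = 0)).resolve_right
        (ht y hy)
      exact ha
    rw [hF y hy, this, zero_mul]

theorem fderiv_apply_eq {f : ℂ × ℂ → ℂ} (y w : ℂ × ℂ) :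
    fderiv ℂ f y w = w.1 * fderiv ℂ f y (1, 0) + w.2 * fderiv ℂ f y (0, 1) := by
  have : w = w.1 • ((1, 0) : ℂ × ℂ) + w.2 • ((0, 1) : ℂ × ℂ) := by ext <;> simp
  conv_lhs => rw [this]
  rw [map_add, map_smul, map_smul, smul_eq_mul, smul_eq_mul]

theorem analyticAt_fderiv_apply {f : ℂ × ℂ → ℂ} {z : ℂ × ℂ} (hf : AnalyticAt ℂ f z)
    (w : ℂ × ℂ) : AnalyticAt ℂ (fun y => fderiv ℂ f y w) z :=
  ((ContinuousLinearMap.apply ℂ ℂ w).analyticAt _).comp hf.fderiv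

theorem analyticAt_binForm {d : ℕ} {b : Fin (d + 1) → ℂ × ℂ → ℂ} {z : ℂ × ℂ}
    (hb : ∀ i, AnalyticAt ℂ (b i) z) {p q : ℂ × ℂ → ℂ} (hp : AnalyticAt ℂ p z)
    (hq : AnalyticAt ℂ q z) : AnalyticAt ℂ (fun y => binForm (fun i => b i y) (p y, q y)) z :=
  Finset.analyticAt_fun_sum _ fun i _ => (hb i).mul ((hp.pow _).mul (hq.pow _))

/-- The slope of the tangent line of an invariant curve is a root of the equation of the web. -/
theorem exists_tangent_slope {d : ℕ} {f : ℂ × ℂ → ℂ} {b : Fin (d + 1) → ℂ × ℂ → ℂ}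
    {t : ℂ} {z₀ : ℂ × ℂ} (hf : AnalyticAt ℂ f z₀) (hf0 : f z₀ = 0) (hdf : fderiv ℂ f z₀ ≠ 0)
    (hb : ∀ i, AnalyticAt ℂ (b i) z₀) (ht : binForm (fun i => b i z₀) (1, t) ≠ 0)
    (hinv : ∀ᶠ y in 𝓝 z₀, f y = 0 →
      binForm (fun i => b i y) (fderiv ℂ f y (1, 0), fderiv ℂ f y (0, 1)) = 0) :
    ∃ c r : ℂ × ℂ → ℂ, AnalyticAt ℂ c z₀ ∧ AnalyticAt ℂ r z₀ ∧ ∀ᶠ y in 𝓝 z₀,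
      fderiv ℂ f y (1, 0) = -c y * fderiv ℂ f y (-t, 1) ∧
        binForm (fun i => b i y) (c y, t * c y - 1) / binForm (fun i => b i y) (1, t) =
          f y * r y := by
  -- Otherwise `df` is a multiple of `(1, t)`, on which the form is nonzero, so invariance would
  -- force `df = 0`.
  have hfB : fderiv ℂ f z₀ (-t, 1) ≠ 0 := by
    intro h
    rw [fderiv_apply_eq] at h
    have h2 : fderiv ℂ f z₀ (0, 1) = t * fderiv ℂ f z₀ (1, 0) := by
      linear_combination h
    have h3 := hinv.self_of_nhds hf0
    have h4 : ((fderiv ℂ f z₀ (1, 0), fderiv ℂ f z₀ (0, 1)) : ℂ × ℂ) =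
        fderiv ℂ f z₀ (1, 0) • ((1, t) : ℂ × ℂ) := by
      ext <;> simp [h2, mul_comm]
    rw [h4, binForm_smul] at h3
    have h5 : fderiv ℂ f z₀ (1, 0) = 0 :=
      eq_zero_of_pow_eq_zero ((mul_eq_zero.1 h3).resolve_right ht)
    refine hdf (ContinuousLinearMap.ext fun w => ?_)
    rw [fderiv_apply_eq, h2, h5]
    simp
  have hA := analyticAt_fderiv_apply hf (1, 0)
  have hB := analyticAt_fderiv_apply hf (-t, 1)
  -- Chosen so that `A + c • B` kills `f`, equivalently so that `(c, t * c - 1)` is proportional to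
  -- `df`. The form then vanishes on this covector along `f = 0`.
  let c : ℂ × ℂ → ℂ := fun y => -fderiv ℂ f y (1, 0) / fderiv ℂ f y (-t, 1)
  have hc : AnalyticAt ℂ c z₀ := hA.neg.div hB hfB
  have hlead := analyticAt_binForm hb (p := fun _ => 1) (q := fun _ => t) analyticAt_const
    analyticAt_const
  have hQ : AnalyticAt ℂ (fun y => binForm (fun i => b i y) (c y, t * c y - 1) /
      binForm (fun i => b i y) (1, t)) z₀ :=
    (analyticAt_binForm hb hc ((analyticAt_const.mul hc).sub analyticAt_const)).div hlead ht
  have hBne := hB.continuousAt.eventually_ne hfB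
  obtain ⟨r, hr, hQr⟩ := exists_analyticAt_eq_mul hQ hf hf0 hdf (by
    filter_upwards [hinv, hBne] with y hy hyB hfy
    have h1 : ((c y, t * c y - 1) : ℂ × ℂ) = (-1 / fderiv ℂ f y (-t, 1)) •
        ((fderiv ℂ f y (1, 0), fderiv ℂ f y (0, 1)) : ℂ × ℂ) := by
      have h2 := fderiv_apply_eq (f := f) y (-t, 1)
      ext
      · simp only [c, Prod.smul_fst, smul_eq_mul]
        ring
      · simp only [c, Prod.smul_snd, smul_eq_mul]
        field_simp
        linear_combination -h2
    rw [h1, binForm_smul, hy hfy, mul_zero, zero_div])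
  refine ⟨c, r, hc, hr, ?_⟩
  filter_upwards [hQr, hBne] with y hy hyB
  refine ⟨?_, hy⟩
  simp only [c]
  field_simp

theorem exists_extacticFunction_of_general {d k m : ℕ} (hd : 1 ≤ d) (hk : 1 ≤ k)
    {F : ℂ × ℂ → ℂ × ℂ → ℂ} {f : ℂ × ℂ → ℂ} {b : Fin (d + 1) → ℂ × ℂ → ℂ}
    {g : Fin (k + 1) → ℂ × ℂ → ℂ} {z₀ : ℂ × ℂ} (hf : AnalyticAt ℂ f z₀) (hf0 : f z₀ = 0)
    (hdf : fderiv ℂ f z₀ ≠ 0) (hb : ∀ i, AnalyticAt ℂ (b i) z₀) (hbz : ∃ i, b i z₀ ≠ 0)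
    (hF : ∀ᶠ y in 𝓝 z₀, ∀ ξ, F y ξ = f y ^ m * binForm (fun i => b i y) ξ)
    (hg : ∀ j, AnalyticAt ℂ (g j) z₀) (V : Submodule ℂ (Fin (k + 1) → ℂ))
    (hV : ∀ v ∈ V, ∀ᶠ y in 𝓝 z₀, f y = 0 → ∑ j, v j * g j y = 0)
    (hinv : V = ⊥ ∨ ∀ᶠ y in 𝓝 z₀, f y = 0 →
      F y (fderiv ℂ f y (1, 0), fderiv ℂ f y (0, 1)) = 0) :
    ∃ E h : ℂ × ℂ → ℂ, IsExtacticFunction d F g E z₀ ∧ AnalyticAt ℂ h z₀ ∧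
      ∀ᶠ y in 𝓝 z₀, E y = f y ^ Module.finrank ℂ V * h y := by
  obtain ⟨t, ht⟩ := exists_binForm_ne_zero hbz
  let bV := Module.finBasis ℂ V
  have hdiv : ∀ l, ∃ h : ℂ × ℂ → ℂ, AnalyticAt ℂ h z₀ ∧
      ∀ᶠ y in 𝓝 z₀, ∑ j, (bV l : Fin (k + 1) → ℂ) j * g j y = f y * h y := fun l =>
    exists_analyticAt_eq_mul
      (Finset.analyticAt_fun_sum _ fun j _ => analyticAt_const.mul (hg j)) hf hf0 hdf
      (hV _ (bV l).2)
  choose h hh hgh using hdiv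
  have hlead := analyticAt_binForm hb (p := fun _ => 1) (q := fun _ => t) analyticAt_const
    analyticAt_const
  have hbase : ∀ᶠ y in 𝓝 z₀, (AnalyticAt ℂ f y ∧ (∀ i, AnalyticAt ℂ (b i) y) ∧
      (∀ j, AnalyticAt ℂ (g j) y) ∧ ∀ l, AnalyticAt ℂ (h l) y) ∧
      (∀ ξ, F y ξ = f y ^ m * binForm (fun i => b i y) ξ) ∧
      binForm (fun i => b i y) (1, t) ≠ 0 ∧
      ∀ l, ∑ j, (bV l : Fin (k + 1) → ℂ) j * g j y = f y * h l y :=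
    (hf.eventually_analyticAt.and ((Filter.eventually_all.2 fun i =>
      (hb i).eventually_analyticAt).and ((Filter.eventually_all.2 fun j =>
      (hg j).eventually_analyticAt).and (Filter.eventually_all.2 fun l =>
      (hh l).eventually_analyticAt)))).and (hF.and ((hlead.continuousAt.eventually_ne ht).and
      (Filter.eventually_all.2 hgh)))
  have hslope : V = ⊥ ∨ 1 ≤ m ∨ ∃ c r : ℂ × ℂ → ℂ, AnalyticAt ℂ c z₀ ∧ AnalyticAt ℂ r z₀ ∧
      ∀ᶠ y in 𝓝 z₀, fderiv ℂ f y (1, 0) = -c y * fderiv ℂ f y (-t, 1) ∧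
        binForm (fun i => b i y) (c y, t * c y - 1) / binForm (fun i => b i y) (1, t) =
          f y * r y := by
    refine hinv.imp_right fun hinv => ?_
    rcases Nat.eq_zero_or_pos m with rfl | hm
    · right
      refine exists_tangent_slope hf hf0 hdf hb ht ?_
      filter_upwards [hinv, hF] with y hy hFy hfy
      have := hy hfy
      rwa [hFy, pow_zero, one_mul] at this
    · exact Or.inl hm
  -- the ring of functions on a small neighbourhood
  have hmain : ∀ U : Set (ℂ × ℂ), ∀ hU : IsOpen U, z₀ ∈ U → ∀ hfU : AnalyticOnNhd ℂ f U,
      (∀ y ∈ U, (∀ i, AnalyticAt ℂ (b i) y) ∧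
      (∀ j, AnalyticAt ℂ (g j) y) ∧ ∀ l, AnalyticAt ℂ (h l) y) →
      (∀ y ∈ U, (∀ ξ, F y ξ = f y ^ m * binForm (fun i => b i y) ξ) ∧
        binForm (fun i => b i y) (1, t) ≠ 0 ∧
        ∀ l, ∑ j, (bV l : Fin (k + 1) → ℂ) j * g j y = f y * h l y) →
      ∃ (a : holo U) (P : (holo U)[X]) (G : Fin (k + 1) → holo U),
        IsExtacticFunction d F g (extacticFn hU d t a P G) z₀ ∧ P.Monic ∧ P.natDegree = d ∧
        (∀ y, (a : ℂ × ℂ → ℂ) y = f y ^ m * binForm (fun i => b i y) (1, t)) ∧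
        (∀ y ∈ U, ∀ x, P.eval₂ (evalAt U y) x =
          binForm (fun i => b i y) (x, t * x - 1) / binForm (fun i => b i y) (1, t)) ∧
        ∀ v ∈ V, extendOne U hU hfU ∣ ∑ j, v j • G j := by
    intro U hU hzU hfU hUa hUe
    obtain ⟨a, P, hP, ha, hPe⟩ := exists_slopePresentation hfU (fun i y hy => (hUa y hy).1 i)
      (fun y hy => (hUe y hy).1) (fun y hy => (hUe y hy).2.1)
    let G : Fin (k + 1) → holo U := fun j => ⟨g j, fun y hy => (hUa y hy).2.1 j⟩
    refine ⟨a, P, G, isExtacticFunction_extacticFn hU hk G hP hzU, hP.monic, hP.natDegree_eq,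
      ha, hPe, fun v hv => ?_⟩
    have hbas : ∀ l, extendOne U hU hfU ∣
        Fintype.linearCombination ℂ G (bV l : Fin (k + 1) → ℂ) := by
      intro l
      refine extendOne_dvd hU hfU (fun y hy => (hUa y hy).2.2 l) fun y hy => ?_
      rw [← (hUe y hy).2.2 l, Fintype.linearCombination_apply]
      simp [G, Finset.sum_apply]
    have hv' : v = ∑ l, bV.repr ⟨v, hv⟩ l • (bV l : Fin (k + 1) → ℂ) := by
      have := congrArg V.subtype (bV.sum_repr ⟨v, hv⟩)
      rw [map_sum] at this
      exact this.symm
    have h1 : ∑ j, v j • G j = Fintype.linearCombination ℂ G v := by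
      rw [Fintype.linearCombination_apply]
    rw [h1, hv', map_sum]
    refine Finset.dvd_sum fun l _ => ?_
    rw [map_smul]
    exact dvd_smul_of_dvd _ (hbas l)
  rcases hslope with rfl | hm | ⟨c, r, hc, hr, hcr⟩
  · obtain ⟨U, hUp, hU, hzU⟩ := eventually_nhds_iff.1 hbase
    obtain ⟨a, P, G, hE, -⟩ := hmain U hU hzU (fun y hy => (hUp y hy).1.1)
      (fun y hy => (hUp y hy).1.2) fun y hy => (hUp y hy).2
    exact ⟨_, _, hE, hE.1, by simp⟩
  · obtain ⟨U, hUp, hU, hzU⟩ := eventually_nhds_iff.1 hbase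
    have hfU : AnalyticOnNhd ℂ f U := fun y hy => (hUp y hy).1.1
    obtain ⟨a, P, G, hE, hPm, hPd, ha, -, hdvd⟩ := hmain U hU hzU hfU
      (fun y hy => (hUp y hy).1.2) fun y hy => (hUp y hy).2
    set lead : ℂ × ℂ → ℂ := fun y => binForm (fun i => b i y) (1, t) with hleaddef
    -- Here `v` vanishes on the curve, so the tangent may fail to be a direction of the reduced
    -- form. The factor `a ^ leadExponent`, with `a` divisible by `f ^ m`, suffices as long as
    -- `finrank V ≤ k`.
    have hN : k ≤ leadExponent d k := by
      have : k ≤ (k + 1) * k / 2 := by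
        rw [Nat.le_div_iff_mul_le two_pos]
        nlinarith
      exact this.trans (Nat.le_add_left _ _)
    have hNm : k ≤ m * leadExponent d k := by nlinarith
    have hn : Module.finrank ℂ V ≤ k + 1 := by
      simpa using Submodule.finrank_le V
    rcases Nat.lt_or_ge k (Module.finrank ℂ V) with hlt | hle
    · have hVtop : V = ⊤ := by
        refine Submodule.eq_top_of_finrank_eq ?_
        rw [Module.finrank_fin_fun]
        omega
      have hG : ∀ j, extendOne U hU hfU ∣ G j := by
        intro j
        have := hdvd (Pi.single j 1) (hVtop ▸ Submodule.mem_top)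
        simpa [Pi.single_apply] using this
      obtain ⟨D, hD⟩ := C_dvd_webDet (δA := dirDer hU (1, 0)) (δB := dirDer hU (-t, 1)) (P := P) hG
      set W := webDet (dirDer hU (1, 0)) (dirDer hU (-t, 1)) P G with hW
      have hres := resultant_C_mul_right P D P.natDegree W.natDegree
        (extendOne U hU hfU)
      rw [← hD] at hres
      -- Now `finrank V = k + 1`: a factor `f` of `webDet` enters the resultant with exponent `deg P
      -- = d ≥ 1`, and `m * leadExponent d k + d ≥ k + 1`.
      obtain ⟨e, he⟩ := Nat.exists_eq_add_of_le
        (show Module.finrank ℂ V ≤ m * leadExponent d k + d by omega)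
      refine ⟨_, fun y => discSign d ^ (k * (k - 1) / 2) * (lead y ^ leadExponent d k * (f y ^ e *
        evalAt U y (resultant P D P.natDegree W.natDegree))), hE, ?_, ?_⟩
      · exact analyticAt_const.mul ((hlead.pow _).mul ((hf.pow _).mul
          (Subtype.property (resultant P D P.natDegree W.natDegree) z₀ hzU)))
      · filter_upwards [hU.mem_nhds hzU] with y hy
        rw [extacticFn, ← hW, hres, map_mul, map_pow, evalAt_apply U y (extendOne U hU hfU),
          extendOne_apply hU _ hy, ha, hPd, mul_pow, ← pow_mul]
        calc _ = discSign d ^ (k * (k - 1) / 2) * (f y ^ (m * leadExponent d k + d) *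
              (lead y ^ leadExponent d k *
                evalAt U y (resultant P D d W.natDegree))) := by
                rw [pow_add]; ring
          _ = _ := by rw [he, pow_add]; ring
    · obtain ⟨e, he⟩ := Nat.exists_eq_add_of_le (hle.trans hNm)
      refine ⟨_, fun y => discSign d ^ (k * (k - 1) / 2) * (lead y ^ leadExponent d k * (f y ^ e *
        evalAt U y (resultant P (webDet (dirDer hU (1, 0)) (dirDer hU (-t, 1)) P G)))), hE, ?_, ?_⟩
      · exact analyticAt_const.mul ((hlead.pow _).mul ((hf.pow _).mul
          (Subtype.property (resultant P _) z₀ hzU)))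
      · refine Filter.Eventually.of_forall fun y => ?_
        rw [extacticFn, ha, mul_pow, ← pow_mul, he, pow_add]
        ring
  · obtain ⟨U, hUp, hU, hzU⟩ := eventually_nhds_iff.1
      (hbase.and (hcr.and (hc.eventually_analyticAt.and hr.eventually_analyticAt)))
    have hfU : AnalyticOnNhd ℂ f U := fun y hy => (hUp y hy).1.1.1
    obtain ⟨a, P, G, hE, hPm, hPd, ha, hPe, hdvd⟩ := hmain U hU hzU hfU
      (fun y hy => (hUp y hy).1.1.2) fun y hy => (hUp y hy).1.2
    classical
    -- An element of `holo U`; off `U` the tangency identity `hfc` reads `0 = 0`, because `dirDer`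
    -- vanishes there.
    let c' : holo U := ⟨fun y => if y ∈ U then c y else 0, fun y hy =>
      (hUp y hy).2.2.1.congr (by filter_upwards [hU.mem_nhds hy] with x hx; simp [hx])⟩
    have hc' : ∀ y ∈ U, (c' : ℂ × ℂ → ℂ) y = c y := fun y hy => if_pos hy
    obtain ⟨r', hr'⟩ : extendOne U hU hfU ∣ P.eval c' := by
      refine extendOne_dvd hU hfU (fun y hy => (hUp y hy).2.2.2) fun y hy => ?_
      rw [← (hUp y hy).2.1.2, ← hPe y hy, ← hc' y hy]
      exact (eval₂_at_apply (evalAt U y) c').symm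
    have hder : ∀ w : ℂ × ℂ, ∀ y ∈ U, (dirDer hU w (extendOne U hU hfU) : ℂ × ℂ → ℂ) y =
        fderiv ℂ f y w := by
      intro w y hy
      rw [dirDer_apply hU _ _ hy]
      have : (extendOne U hU hfU : ℂ × ℂ → ℂ) =ᶠ[𝓝 y] f := by
        filter_upwards [hU.mem_nhds hy] with x hx
        exact extendOne_apply hU hfU hx
      rw [this.fderiv_eq]
    have hfc : dirDer hU (1, 0) (extendOne U hU hfU) =
        -c' * dirDer hU (-t, 1) (extendOne U hU hfU) := by
      ext y
      by_cases hy : y ∈ U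
      · rw [hder _ y hy, (hUp y hy).2.1.1, ← hder _ y hy, ← hc' y hy]
        rfl
      · have h0 : ∀ w, (dirDer hU w (extendOne U hU hfU) : ℂ × ℂ → ℂ) y = 0 := fun w =>
          if_neg hy
        rw [h0]
        change _ = -(c' : ℂ × ℂ → ℂ) y * (dirDer hU (-t, 1) (extendOne U hU hfU) : ℂ × ℂ → ℂ) y
        rw [h0, mul_zero]
    obtain ⟨M, hM⟩ := exists_bound_resultant hzU hPm hr' (webDet_mem_span_pow hr' hfc G V hdvd)
    let A : ℂ × ℂ → ℂ := fun y => discSign d ^ (k * (k - 1) / 2) *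
      (a : ℂ × ℂ → ℂ) y ^ leadExponent d k
    have hA : AnalyticAt ℂ A z₀ := analyticAt_const.mul ((a.2 z₀ hzU).pow _)
    have hAb : ∀ᶠ y in 𝓝 z₀, ‖A y‖ ≤ ‖A z₀‖ + 1 :=
      (hA.continuousAt.norm.eventually_lt_const (lt_add_one _)).mono fun y hy => hy.le
    obtain ⟨q, hq, hEq⟩ := exists_analyticAt_eq_pow_mul hE.1 hf hf0 hdf (Module.finrank ℂ V)
      ((‖A z₀‖ + 1) * M) (by
        filter_upwards [hAb, hM, hU.mem_nhds hzU] with y h1 h2 hy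
        rw [evalAt_apply U y (extendOne _ _ _), extendOne_apply hU _ hy] at h2
        rw [extacticFn, ← mul_assoc, norm_mul, mul_assoc (‖A z₀‖ + 1)]
        exact mul_le_mul h1 h2 (norm_nonneg _) (by positivity))
    exact ⟨_, q, hE, hq, hEq⟩

/-- Near every smooth point of a curve there are points of the curve at which the extactic function
is holomorphic and divisible by the expected power of the equation of the curve. -/
theorem frequently_exists_extacticFunction {d k : ℕ} (hd : 1 ≤ d) (hk : 1 ≤ k)
    {F : ℂ × ℂ → ℂ × ℂ → ℂ} {f : ℂ × ℂ → ℂ} {a : Fin (d + 1) → ℂ × ℂ → ℂ}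
    {g : Fin (k + 1) → ℂ × ℂ → ℂ} {z₀ : ℂ × ℂ} (hf : AnalyticAt ℂ f z₀) (hf0 : f z₀ = 0)
    (hdf : fderiv ℂ f z₀ ≠ 0) (ha : ∀ i, AnalyticAt ℂ (a i) z₀)
    (hF : ∀ᶠ y in 𝓝 z₀, ∀ ξ, F y ξ = binForm (fun i => a i y) ξ)
    (hg : ∀ j, AnalyticAt ℂ (g j) z₀) (V : Submodule ℂ (Fin (k + 1) → ℂ))
    (hV : ∀ᶠ y in 𝓝 z₀, f y = 0 → ∀ v ∈ V, ∑ j, v j * g j y = 0)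
    (hinv : V = ⊥ ∨ ∀ᶠ y in 𝓝 z₀, f y = 0 →
      F y (fderiv ℂ f y (1, 0), fderiv ℂ f y (0, 1)) = 0) :
    ∃ᶠ z in 𝓝 z₀, f z = 0 ∧ ∃ E h : ℂ × ℂ → ℂ, IsExtacticFunction d F g E z ∧
      AnalyticAt ℂ h z ∧ ∀ᶠ y in 𝓝 z, E y = f y ^ Module.finrank ℂ V * h y := by
  -- If `v` is zero near `z₀`, the function `E = 0` is divisible by any power. Otherwise, after
  -- removal of `f ^ m`, the remaining form is nonzero at points of the curve arbitrarily close to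
  -- `z₀`.
  rcases exists_order_along ha hf hf0 hdf with h0 | ⟨m, b, hb, hab, hfreq⟩
  · have hF0 : ∀ᶠ y in 𝓝 z₀, ∀ ξ, F y ξ = 0 := by
      filter_upwards [h0, hF] with y h1 h2 ξ
      rw [h2]
      simp [binForm, h1]
    intro hn
    exact hn.self_of_nhds ⟨hf0, _, fun _ => 0, isExtacticFunction_zero hk hF0, analyticAt_const,
      by simp⟩
  · have hev : ∀ᶠ z in 𝓝 z₀, AnalyticAt ℂ f z ∧ fderiv ℂ f z ≠ 0 ∧ (∀ i, AnalyticAt ℂ (b i) z) ∧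
        (∀ᶠ y in 𝓝 z, ∀ ξ, F y ξ = f y ^ m * binForm (fun i => b i y) ξ) ∧
        (∀ j, AnalyticAt ℂ (g j) z) ∧
        (∀ v ∈ V, ∀ᶠ y in 𝓝 z, f y = 0 → ∑ j, v j * g j y = 0) ∧
        (V = ⊥ ∨ ∀ᶠ y in 𝓝 z, f y = 0 →
          F y (fderiv ℂ f y (1, 0), fderiv ℂ f y (0, 1)) = 0) := by
      have hFm : ∀ᶠ y in 𝓝 z₀, ∀ ξ, F y ξ = f y ^ m * binForm (fun i => b i y) ξ := by
        filter_upwards [hF, hab] with y h1 h2 ξ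
        rw [h1, binForm, binForm, Finset.mul_sum]
        exact Finset.sum_congr rfl fun i _ => by rw [h2]; ring
      have hinv' : ∀ᶠ z in 𝓝 z₀, (V = ⊥ ∨ ∀ᶠ y in 𝓝 z, f y = 0 →
          F y (fderiv ℂ f y (1, 0), fderiv ℂ f y (0, 1)) = 0) := by
        rcases hinv with h | h
        · exact Filter.Eventually.of_forall fun _ => Or.inl h
        · exact h.eventually_nhds.mono fun _ => Or.inr
      filter_upwards [hf.eventually_analyticAt, eventually_fderiv_ne_zero hf hdf,
        Filter.eventually_all.2 fun i => (hb i).eventually_analyticAt, hFm.eventually_nhds,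
        Filter.eventually_all.2 fun j => (hg j).eventually_analyticAt, hV.eventually_nhds,
        hinv'] with z h1 h2 h3 h4 h5 h6 h7
      exact ⟨h1, h2, h3, h4, h5, fun v hv => h6.mono fun y hy hfy => hy hfy v hv, h7⟩
    refine (hfreq.and_eventually hev).mono ?_
    rintro z ⟨⟨hz, hbz⟩, h1, h2, h3, h4, h5, h6, h7⟩
    exact ⟨hz, exists_extacticFunction_of_general hd hk h1 hz h2 h3 hbz h4 h5 V h6 h7⟩

end ExtacticWeb

namespace ExtacticWeb

/-! ## Coordinates and trivializations on a surface -/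

section Surface

variable {X : Type*} [TopologicalSpace X] [ChartedSpace (ℂ × ℂ) X]

theorem analyticAt_comp_symm [IsManifold 𝓘(ℂ, ℂ × ℂ) ω X] {φ : OpenPartialHomeomorph X (ℂ × ℂ)}
    (hφ : φ ∈ IsManifold.maximalAtlas 𝓘(ℂ, ℂ × ℂ) ω X) {F : X → ℂ} {z : ℂ × ℂ} (hz : z ∈ φ.target)
    (hF : ContMDiffAt 𝓘(ℂ, ℂ × ℂ) 𝓘(ℂ, ℂ) ω F (φ.symm z)) : AnalyticAt ℂ (F ∘ φ.symm) z := by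
  have h1 : ContMDiffAt 𝓘(ℂ, ℂ × ℂ) 𝓘(ℂ, ℂ × ℂ) ω φ.symm z :=
    contMDiffAt_symm_of_mem_maximalAtlas hφ hz
  exact (hF.comp z h1).contDiffAt.analyticAt

theorem dform_eq [IsManifold 𝓘(ℂ, ℂ × ℂ) ω X] {φ : OpenPartialHomeomorph X (ℂ × ℂ)}
    (hφ : φ ∈ IsManifold.maximalAtlas 𝓘(ℂ, ℂ × ℂ) ω X) {F : X → ℂ} {x : X} (hx : x ∈ φ.source)
    (hF : AnalyticAt ℂ (F ∘ φ.symm) (φ x)) :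
    dform F x = fderiv ℂ (F ∘ φ.symm) (φ x) (1, 0) • dform (fun y => (φ y).1) x +
      fderiv ℂ (F ∘ φ.symm) (φ x) (0, 1) • dform (fun y => (φ y).2) x := by
  have h1 : MDifferentiableAt 𝓘(ℂ, ℂ × ℂ) 𝓘(ℂ, ℂ × ℂ) φ x :=
    (contMDiffAt_of_mem_maximalAtlas hφ hx).mdifferentiableAt (by simp)
  have h2 : ∀ {G : ℂ × ℂ → ℂ}, DifferentiableAt ℂ G (φ x) →
      dform (fun y => G (φ y)) x = (fderiv ℂ G (φ x)).comp
        (mfderiv 𝓘(ℂ, ℂ × ℂ) 𝓘(ℂ, ℂ × ℂ) φ x) := by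
    intro G hG
    have := mfderiv_comp x hG.mdifferentiableAt h1
    rw [mfderiv_eq_fderiv] at this
    exact this
  have h3 : dform F x = dform (fun y => (F ∘ φ.symm) (φ y)) x := by
    refine Filter.EventuallyEq.mfderiv_eq ?_
    filter_upwards [φ.open_source.mem_nhds hx] with y hy
    simp [φ.left_inv hy]
  have h4 := h2 (G := Prod.fst) differentiableAt_fst
  have h5 := h2 (G := Prod.snd) differentiableAt_snd
  rw [h3, h2 hF.differentiableAt, h4, h5, fderiv_fst, fderiv_snd]
  ext w
  change fderiv ℂ (F ∘ φ.symm) (φ x) (mfderiv 𝓘(ℂ, ℂ × ℂ) 𝓘(ℂ, ℂ × ℂ) φ x w) =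
    fderiv ℂ (F ∘ φ.symm) (φ x) (1, 0) * (mfderiv 𝓘(ℂ, ℂ × ℂ) 𝓘(ℂ, ℂ × ℂ) φ x w : ℂ × ℂ).1 +
    fderiv ℂ (F ∘ φ.symm) (φ x) (0, 1) * (mfderiv 𝓘(ℂ, ℂ × ℂ) 𝓘(ℂ, ℂ × ℂ) φ x w : ℂ × ℂ).2
  exact (fderiv_apply_eq (φ x) _).trans (congrArg₂ (· + ·) (mul_comm _ _) (mul_comm _ _))

theorem dform_eq_zero [IsManifold 𝓘(ℂ, ℂ × ℂ) ω X] {φ : OpenPartialHomeomorph X (ℂ × ℂ)}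
    (hφ : φ ∈ IsManifold.maximalAtlas 𝓘(ℂ, ℂ × ℂ) ω X) {F : X → ℂ} {x : X} (hx : x ∈ φ.source)
    (hF : AnalyticAt ℂ (F ∘ φ.symm) (φ x)) (h : fderiv ℂ (F ∘ φ.symm) (φ x) = 0) :
    dform F x = 0 := by
  rw [dform_eq hφ hx hF, h]
  ext w
  change 0 * dform (fun y => (φ y).1) x w + 0 * dform (fun y => (φ y).2) x w = 0
  rw [zero_mul, zero_mul, add_zero]

variable {N : X → Type*} [TopologicalSpace (TotalSpace ℂ N)] [∀ x, TopologicalSpace (N x)]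
  [∀ x, AddCommGroup (N x)] [∀ x, Module ℂ (N x)] [FiberBundle ℂ N] [VectorBundle ℂ ℂ N]

theorem analyticAt_section [IsManifold 𝓘(ℂ, ℂ × ℂ) ω X]
    [ContMDiffVectorBundle ω ℂ N 𝓘(ℂ, ℂ × ℂ)] {φ : OpenPartialHomeomorph X (ℂ × ℂ)}
    (hφ : φ ∈ IsManifold.maximalAtlas 𝓘(ℂ, ℂ × ℂ) ω X)
    (e : Trivialization ℂ (TotalSpace.proj : TotalSpace ℂ N → X)) [MemTrivializationAtlas e]
    {s : (x : X) → N x} {z : ℂ × ℂ} (hz : z ∈ φ.target) (he : φ.symm z ∈ e.baseSet)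
    (hs : ContMDiffAt 𝓘(ℂ, ℂ × ℂ) (𝓘(ℂ, ℂ × ℂ).prod 𝓘(ℂ, ℂ)) ω
      (fun x => TotalSpace.mk' ℂ x (s x)) (φ.symm z)) :
    AnalyticAt ℂ (localSection φ e s) z :=
  analyticAt_comp_symm hφ hz ((e.contMDiffAt_section_iff he).1 hs)

omit [ChartedSpace (ℂ × ℂ) X] in
theorem localSection_eq (φ : OpenPartialHomeomorph X (ℂ × ℂ))
    (e : Trivialization ℂ (TotalSpace.proj : TotalSpace ℂ N → X)) [MemTrivializationAtlas e]
    (s : (x : X) → N x) {z : ℂ × ℂ} (he : φ.symm z ∈ e.baseSet) :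
    localSection φ e s z = e.linearMapAt ℂ (φ.symm z) (s (φ.symm z)) := by
  rw [e.coe_linearMapAt_of_mem he]
  rfl

/-- The coefficients of a symmetric field in coordinates. -/
noncomputable def webCoeff {d : ℕ} (φ : OpenPartialHomeomorph X (ℂ × ℂ))
    (e : Trivialization ℂ (TotalSpace.proj : TotalSpace ℂ N → X))
    (v : TwistedSymField d N) (i : Fin (d + 1)) (z : ℂ × ℂ) : ℂ :=
  ∑ T ∈ (Finset.univ : Finset (Fin d)).powersetCard i, localSection φ e
    (fun x => v.toFun x fun j => dform (if j ∈ T then fun y => (φ y).1 else fun y => (φ y).2) x) z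

theorem analyticAt_webCoeff [IsManifold 𝓘(ℂ, ℂ × ℂ) ω X]
    [ContMDiffVectorBundle ω ℂ N 𝓘(ℂ, ℂ × ℂ)] {d : ℕ} {φ : OpenPartialHomeomorph X (ℂ × ℂ)}
    (hφ : φ ∈ IsManifold.maximalAtlas 𝓘(ℂ, ℂ × ℂ) ω X)
    (e : Trivialization ℂ (TotalSpace.proj : TotalSpace ℂ N → X)) [MemTrivializationAtlas e]
    (v : TwistedSymField d N) (i : Fin (d + 1)) {z : ℂ × ℂ} (hz : z ∈ φ.target)
    (he : φ.symm z ∈ e.baseSet) : AnalyticAt ℂ (webCoeff φ e v i) z := by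
  refine Finset.analyticAt_fun_sum _ fun T _ => ?_
  refine analyticAt_section hφ e hz he ?_
  have h := v.holomorphic φ.source
    (fun j => if j ∈ T then fun y => (φ y).1 else fun y => (φ y).2) φ.open_source ?_
  · exact h.contMDiffAt (φ.open_source.mem_nhds (φ.map_target hz))
  · intro j
    have h1 := contMDiffOn_of_mem_maximalAtlas hφ
    by_cases hj : j ∈ T
    · simp only [hj, if_true]
      exact (ContinuousLinearMap.fst ℂ ℂ ℂ).contMDiff.comp_contMDiffOn h1
    · simp only [hj, if_false]
      exact (ContinuousLinearMap.snd ℂ ℂ ℂ).contMDiff.comp_contMDiffOn h1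

/-- Multilinear expansion over the set `T` of slots receiving the first coordinate differential,
grouped by the cardinality of `T`. -/
theorem localWeb_eq_binForm {d : ℕ} (φ : OpenPartialHomeomorph X (ℂ × ℂ))
    (e : Trivialization ℂ (TotalSpace.proj : TotalSpace ℂ N → X)) [MemTrivializationAtlas e]
    (v : TwistedSymField d N) {z : ℂ × ℂ} (he : φ.symm z ∈ e.baseSet) (ξ : ℂ × ℂ) :
    localWeb φ e v z ξ = binForm (fun i => webCoeff φ e v i z) ξ := by
  set x := φ.symm z with hx
  set α : TangentSpace 𝓘(ℂ, ℂ × ℂ) x →L[ℂ] ℂ := dform (fun y => (φ y).1) x with hα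
  set β : TangentSpace 𝓘(ℂ, ℂ × ℂ) x →L[ℂ] ℂ := dform (fun y => (φ y).2) x with hβ
  have h1 : localWeb φ e v z ξ =
      e.linearMapAt ℂ x (v.toFun x fun _ => ξ.1 • α + ξ.2 • β) :=
    localSection_eq φ e (fun x => v.toFun x fun _ => ξ.1 • dform (fun y => (φ y).1) x +
      ξ.2 • dform (fun y => (φ y).2) x) he
  have h2 : (v.toFun x fun _ => ξ.1 • α + ξ.2 • β) = ∑ T : Finset (Fin d),
      (ξ.1 ^ T.card * ξ.2 ^ (d - T.card)) •
        v.toFun x fun j => dform (if j ∈ T then fun y => (φ y).1 else fun y => (φ y).2) x := by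
    have h3 := (v.toFun x).map_add_univ (fun _ => ξ.1 • α) (fun _ => ξ.2 • β)
    refine h3.trans (Finset.sum_congr rfl fun T _ => ?_)
    have h4 : T.piecewise (fun _ => ξ.1 • α) (fun _ => ξ.2 • β) = fun j : Fin d =>
        (if j ∈ T then ξ.1 else ξ.2) •
          dform (if j ∈ T then fun y => (φ y).1 else fun y => (φ y).2) x := by
      ext1 j
      by_cases hj : j ∈ T <;> simp [hj, hα, hβ]
    rw [h4, MultilinearMap.map_smul_univ]
    congr 1
    rw [Finset.prod_ite, Finset.prod_const, Finset.prod_const]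
    congr 2
    · congr 1; ext; simp
    · rw [Finset.filter_not, Finset.card_sdiff_of_subset (Finset.filter_subset _ _)]
      simp
  rw [h1, h2, map_sum, binForm, ← Finset.powerset_univ, Finset.sum_powerset, Finset.card_univ,
    Fintype.card_fin, ← Fin.sum_univ_eq_sum_range (fun j : ℕ => ∑ T ∈
      (Finset.univ : Finset (Fin d)).powersetCard j, e.linearMapAt ℂ x
        ((ξ.1 ^ T.card * ξ.2 ^ (d - T.card)) • v.toFun x fun j =>
          dform (if j ∈ T then fun y => (φ y).1 else fun y => (φ y).2) x)) (d + 1)]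
  refine Finset.sum_congr rfl fun i _ => ?_
  rw [webCoeff, Finset.sum_mul]
  refine Finset.sum_congr rfl fun T hT => ?_
  rw [localSection_eq φ e _ he, map_smul, (Finset.mem_powersetCard.1 hT).2, smul_eq_mul, mul_comm]

theorem localWeb_eq {d : ℕ} (φ : OpenPartialHomeomorph X (ℂ × ℂ))
    (e : Trivialization ℂ (TotalSpace.proj : TotalSpace ℂ N → X)) [MemTrivializationAtlas e]
    (v : TwistedSymField d N) {z : ℂ × ℂ} (he : φ.symm z ∈ e.baseSet) (ξ : ℂ × ℂ) :
    localWeb φ e v z ξ = e.linearMapAt ℂ (φ.symm z) (v.toFun (φ.symm z) fun _ =>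
      ξ.1 • dform (fun y => (φ y).1) (φ.symm z) + ξ.2 • dform (fun y => (φ y).2) (φ.symm z)) :=
  localSection_eq φ e (fun x => v.toFun x fun _ => ξ.1 • dform (fun y => (φ y).1) x +
    ξ.2 • dform (fun y => (φ y).2) x) he

end Surface

/-! ### Sections vanishing on a curve and transfer to the surface -/

variable {X : Type*} [TopologicalSpace X] [ChartedSpace (ℂ × ℂ) X]
  [IsManifold 𝓘(ℂ, ℂ × ℂ) ω X]
  {N L : X → Type*}
  [TopologicalSpace (TotalSpace ℂ N)] [∀ x, TopologicalSpace (N x)] [∀ x, AddCommGroup (N x)]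
  [∀ x, Module ℂ (N x)] [FiberBundle ℂ N] [VectorBundle ℂ ℂ N]
  [ContMDiffVectorBundle ω ℂ N 𝓘(ℂ, ℂ × ℂ)]
  [TopologicalSpace (TotalSpace ℂ L)] [∀ x, TopologicalSpace (L x)] [∀ x, AddCommGroup (L x)]
  [∀ x, Module ℂ (L x)] [FiberBundle ℂ L] [VectorBundle ℂ ℂ L]
  [ContMDiffVectorBundle ω ℂ L 𝓘(ℂ, ℂ × ℂ)]

omit [IsManifold 𝓘(ℂ, ℂ × ℂ) ω X] [ContMDiffVectorBundle ω ℂ N 𝓘(ℂ, ℂ × ℂ)] in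
/-- The elements of `W` which vanish on `C`, in terms of a basis of `W`. -/
theorem exists_vanishing_submodule {k : ℕ}
    (W : Submodule ℂ (ContMDiffSection 𝓘(ℂ, ℂ × ℂ) ℂ ω N)) (C : Set X)
    (s : Module.Basis (Fin (k + 1)) ℂ W) :
    ∃ V : Submodule ℂ (Fin (k + 1) → ℂ),
      Module.finrank ℂ V = ((k : ℤ) - restrictedDim W C).toNat ∧
      ∀ a ∈ V, ∀ x ∈ C,
        ∑ j, a j • (s j : ContMDiffSection 𝓘(ℂ, ℂ × ℂ) ℂ ω N) x = 0 := by
  let T : (Fin (k + 1) → ℂ) →ₗ[ℂ] ((x : C) → N x) :=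
    (restrictSection N C).comp (W.subtype.comp s.equivFun.symm.toLinearMap)
  refine ⟨LinearMap.ker T, ?_, fun a ha x hx => ?_⟩
  · have h1 : LinearMap.range T = W.map (restrictSection N C) := by
      rw [LinearMap.range_comp, LinearMap.range_comp, LinearEquiv.range, Submodule.map_top,
        Submodule.range_subtype]
    -- Rank-nullity: `k + 1 = (k_C + 1) + finrank V`, so the integer difference is nonnegative and
    -- `toNat` loses nothing.
    have h2 := T.finrank_range_add_finrank_ker
    rw [h1, Module.finrank_fin_fun] at h2
    unfold restrictedDim
    omega
  · have h1 := congrFun (LinearMap.mem_ker.1 ha) ⟨x, hx⟩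
    have h2 : T a ⟨x, hx⟩ = ((s.equivFun.symm a : W) : ContMDiffSection 𝓘(ℂ, ℂ × ℂ) ℂ ω N) x := rfl
    rw [h2, s.equivFun_symm_apply] at h1
    have h3 : ∀ f : Fin (k + 1) → W,
        ((∑ j, f j : W) : ContMDiffSection 𝓘(ℂ, ℂ × ℂ) ℂ ω N) x =
          ∑ j, (f j : ContMDiffSection 𝓘(ℂ, ℂ × ℂ) ℂ ω N) x := by
      intro f
      let ev : ContMDiffSection 𝓘(ℂ, ℂ × ℂ) ℂ ω N →+ N x :=
        { toFun := fun σ => σ x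
          map_zero' := rfl
          map_add' := fun _ _ => rfl }
      exact map_sum (ev.comp W.subtype.toAddMonoidHom) f Finset.univ
    rw [h3] at h1
    exact h1

/-- Pure dimension one gives a smooth point of `H` in every open set meeting `H`; near it the planar
result gives a general point. Taking `V = ⊥` treats curves that need not be invariant. -/
theorem subset_closure_extactic {k : ℕ} (hk : 1 ≤ k)
    {W : Submodule ℂ (ContMDiffSection 𝓘(ℂ, ℂ × ℂ) ℂ ω N)} {d : ℕ} (hd : 1 ≤ d)
    (v : TwistedSymField d L) {H : Set X} (hH : IsIrreducibleCurve H)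
    {φ : OpenPartialHomeomorph X (ℂ × ℂ)} (hφ : φ ∈ IsManifold.maximalAtlas 𝓘(ℂ, ℂ × ℂ) ω X)
    (eN : Trivialization ℂ (TotalSpace.proj : TotalSpace ℂ N → X)) [MemTrivializationAtlas eN]
    (eL : Trivialization ℂ (TotalSpace.proj : TotalSpace ℂ L → X)) [MemTrivializationAtlas eL]
    (s : Module.Basis (Fin (k + 1)) ℂ W) (V : Submodule ℂ (Fin (k + 1) → ℂ))
    (hV : ∀ a ∈ V, ∀ x ∈ H, ∑ j, a j • (s j : ContMDiffSection 𝓘(ℂ, ℂ × ℂ) ℂ ω N) x = 0)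
    (hinv : V = ⊥ ∨ IsInvariant H v) :
    H ∩ (φ.source ∩ eN.baseSet ∩ eL.baseSet) ⊆
      closure {q | q ∈ H ∩ (φ.source ∩ eN.baseSet ∩ eL.baseSet) ∧ ∃ f E h : ℂ × ℂ → ℂ,
        IsSmoothEquation (φ.target ∩ φ.symm ⁻¹' H) f (φ q) ∧
        IsExtacticFunction d (localWeb φ eL v)
          (fun j => localSection φ eN (s j : ContMDiffSection 𝓘(ℂ, ℂ × ℂ) ℂ ω N)) E (φ q) ∧
        AnalyticAt ℂ h (φ q) ∧ ∀ᶠ z in 𝓝 (φ q), E z = f z ^ Module.finrank ℂ V * h z} := by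
  rintro q₀ ⟨hq₀, hq₀O⟩
  rw [mem_closure_iff]
  intro G hG hq₀G
  set O := φ.source ∩ eN.baseSet ∩ eL.baseSet with hO
  have hOo : IsOpen O := (φ.open_source.inter eN.open_baseSet).inter eL.open_baseSet
  obtain ⟨p, ⟨hpG, hpO⟩, f₀, hpH, hf₀, hdf₀, hf₀H⟩ :=
    mem_closure_iff.1 (hH.pure_dim_one hq₀) (G ∩ O) (hG.inter hOo) ⟨hq₀G, hq₀O⟩
  set z₀ := φ p with hz₀
  have hps : p ∈ φ.source := hpO.1.1
  have hz₀t : z₀ ∈ φ.target := φ.map_source hps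
  have hsz : φ.symm z₀ = p := φ.left_inv hps
  let f : ℂ × ℂ → ℂ := f₀ ∘ φ.symm
  have hfa : AnalyticAt ℂ f z₀ := analyticAt_comp_symm hφ hz₀t (by rwa [hsz])
  have htend : Filter.Tendsto φ.symm (𝓝 z₀) (𝓝 p) := by
    have := (φ.continuousAt_symm hz₀t).tendsto
    rwa [hsz] at this
  have hfH : ∀ᶠ z in 𝓝 z₀, (φ.symm z ∈ H ↔ f z = 0) := htend.eventually hf₀H
  have hf0 : f z₀ = 0 := hfH.self_of_nhds.1 (by rwa [hsz])
  have hdf : fderiv ℂ f z₀ ≠ 0 := by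
    intro h
    apply hdf₀
    exact dform_eq_zero hφ hps hfa h
  have htO : ∀ᶠ z in 𝓝 z₀, z ∈ φ.target ∧ φ.symm z ∈ G ∩ O :=
    (φ.open_target.eventually_mem hz₀t).and
      (htend.eventually ((hG.inter hOo).mem_nhds ⟨hpG, hpO⟩))
  -- Invariance is a condition at each point with a local equation there, so `f₀` has to serve as
  -- one at all nearby points of `H`, not only at `p`.
  have hloc : ∀ᶠ z in 𝓝 z₀, f z = 0 → IsLocalEquation H f₀ (φ.symm z) := by
    have h1 : ∀ᶠ x in 𝓝 p, ContMDiffAt 𝓘(ℂ, ℂ × ℂ) 𝓘(ℂ, ℂ) ω f₀ x := 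
      (contMDiffAt_iff_contMDiffAt_nhds (by simp)).1 hf₀
    filter_upwards [htend.eventually h1, htend.eventually hf₀H.eventually_nhds, htO,
      eventually_fderiv_ne_zero hfa hdf, hfa.eventually_analyticAt] with z h2 h3 h4 h5 h6 hz
    refine ⟨h3.self_of_nhds.2 hz, h2, fun h0 => h5 ?_, h3⟩
    have hcomp : f =ᶠ[𝓝 z] fun y => f₀ (φ.symm y) := Filter.EventuallyEq.rfl
    have h7 : mfderiv 𝓘(ℂ, ℂ × ℂ) 𝓘(ℂ, ℂ) f z =
        (mfderiv 𝓘(ℂ, ℂ × ℂ) 𝓘(ℂ, ℂ) f₀ (φ.symm z)).comp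
          (mfderiv 𝓘(ℂ, ℂ × ℂ) 𝓘(ℂ, ℂ × ℂ) φ.symm z) :=
      mfderiv_comp z (h2.mdifferentiableAt (by simp))
        ((contMDiffAt_symm_of_mem_maximalAtlas hφ h4.1).mdifferentiableAt (by simp))
    have h8 : mfderiv 𝓘(ℂ, ℂ × ℂ) 𝓘(ℂ, ℂ) f₀ (φ.symm z) = 0 := h0
    rw [h8, ContinuousLinearMap.zero_comp, mfderiv_eq_fderiv] at h7
    exact h7
  have hfreq := frequently_exists_extacticFunction hd hk (F := localWeb φ eL v)
    (a := webCoeff φ eL v)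
    (g := fun j => localSection φ eN (s j : ContMDiffSection 𝓘(ℂ, ℂ × ℂ) ℂ ω N)) hfa hf0 hdf
    (fun i => analyticAt_webCoeff hφ eL v i hz₀t (by rw [hsz]; exact hpO.2))
    (htO.mono fun z hz ξ => localWeb_eq_binForm φ eL v hz.2.2.2 ξ)
    (fun j => analyticAt_section hφ eN hz₀t (by rw [hsz]; exact hpO.1.2)
      ((s j : ContMDiffSection 𝓘(ℂ, ℂ × ℂ) ℂ ω N).contMDiff (φ.symm z₀))) V
    (by
      filter_upwards [hfH, htO] with z h1 h2 hz a ha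
      have h3 := congrArg (eN.linearMapAt ℂ (φ.symm z)) (hV a ha _ (h1.2 hz))
      rw [map_sum, map_zero] at h3
      rw [← h3]
      refine Finset.sum_congr rfl fun j _ => ?_
      rw [localSection_eq φ eN _ h2.2.2.1.2, map_smul, smul_eq_mul])
    (by
      refine hinv.imp_right fun hinv => ?_
      filter_upwards [hloc, htO, hfa.eventually_analyticAt] with z h1 h2 h3 hz
      have h4 := hinv _ _ (h1 hz)
      have h5 : φ (φ.symm z) = z := φ.right_inv h2.1
      have h6 := dform_eq hφ (φ.map_target h2.1) (F := f₀) (by rw [h5]; exact h3)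
      rw [h5] at h6
      rw [localWeb_eq φ eL v h2.2.2.2]
      change eL.linearMapAt ℂ (φ.symm z) (v.toFun (φ.symm z) fun _ =>
        fderiv ℂ (f₀ ∘ φ.symm) z (1, 0) • dform (fun y => (φ y).1) (φ.symm z) +
          fderiv ℂ (f₀ ∘ φ.symm) z (0, 1) • dform (fun y => (φ y).2) (φ.symm z)) = 0
      rw [← h6, h4, map_zero])
  obtain ⟨z, ⟨hz, E, h, hE, hh, hEh⟩, hzO, hza, hzd, hzH⟩ := (hfreq.and_eventually
    (htO.and (hfa.eventually_analyticAt.and ((eventually_fderiv_ne_zero hfa hdf).and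
      hfH.eventually_nhds)))).exists
  have hφz : φ (φ.symm z) = z := φ.right_inv hzO.1
  refine ⟨φ.symm z, hzO.2.1, ⟨hzH.self_of_nhds.2 hz, hzO.2.2⟩, f, E, h, ?_⟩
  rw [hφz]
  refine ⟨⟨⟨hzO.1, hzH.self_of_nhds.2 hz⟩, hza, hzd, ?_⟩, hE, hh, hEh⟩
  filter_upwards [hzH, φ.open_target.mem_nhds hzO.1] with y hy hyt
  exact ⟨fun h => hy.1 h.2, fun h => ⟨hyt, hy.2 h⟩⟩

end ExtacticWeb

theorem propositionP
    {X : Type*} [TopologicalSpace X] [T2Space X] [ConnectedSpace X]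
    [ChartedSpace (ℂ × ℂ) X] [IsManifold 𝓘(ℂ, ℂ × ℂ) ω X]
    (N L : X → Type*)
    [TopologicalSpace (TotalSpace ℂ N)] [∀ x, TopologicalSpace (N x)] [∀ x, AddCommGroup (N x)]
    [∀ x, Module ℂ (N x)] [FiberBundle ℂ N] [VectorBundle ℂ ℂ N]
    [ContMDiffVectorBundle ω ℂ N 𝓘(ℂ, ℂ × ℂ)]
    [TopologicalSpace (TotalSpace ℂ L)] [∀ x, TopologicalSpace (L x)] [∀ x, AddCommGroup (L x)]
    [∀ x, Module ℂ (L x)] [FiberBundle ℂ L] [VectorBundle ℂ ℂ L]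
    [ContMDiffVectorBundle ω ℂ L 𝓘(ℂ, ℂ × ℂ)]
    (k : ℕ) (hk : 1 ≤ k)
    (W : Submodule ℂ (ContMDiffSection 𝓘(ℂ, ℂ × ℂ) ℂ ω N)) (hW : Module.finrank ℂ W = k + 1)
    (d : ℕ) (hd : 1 ≤ d)
    (v : ExtacticWeb.TwistedSymField d L) (hv : ExtacticWeb.IsWeb v)
    (C : Set X) (hC : ExtacticWeb.IsIrreducibleCurve C) (hinv : ExtacticWeb.IsInvariant C v) :
    ExtacticWeb.ExtacticCoeffGE k W v C ((k : ℤ) - ExtacticWeb.restrictedDim W C).toNat ∧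
      ∀ H : Set X, ExtacticWeb.IsIrreducibleCurve H → ExtacticWeb.ExtacticCoeffGE k W v H 0 := by
  refine ⟨fun φ hφ eN _ eL _ s => ?_, fun H hH φ hφ eN _ eL _ s => ?_⟩
  · obtain ⟨V, hV, hVC⟩ := ExtacticWeb.exists_vanishing_submodule W C s
    rw [← hV]
    exact ExtacticWeb.subset_closure_extactic hk hd v hC hφ eN eL s V hVC (Or.inr hinv)
  · have h := ExtacticWeb.subset_closure_extactic hk hd v hH hφ eN eL s ⊥
      (fun a ha x _ => by simp [(Submodule.mem_bot ℂ).1 ha]) (Or.inl rfl)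
    rwa [finrank_bot] at h
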